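/- For $0<p<\infty$, the Hardy space $H^p$ consists of the analytic functions $f$ in the unit disc $\mathbb D$ with $$\|f\|_{H^p}:=\sup_{0<r<1}\Big(\int_0^{2\pi}|f(re^{i\theta})|^p\,\frac{d\theta}{2\pi}\Big)^{1/p}<\infty .$$ For $0<p<\infty$ and $\alpha>1$, the Bergman space $A^p_\alpha$ is the space of analytic functions in $\mathbb D$ that lie in the closure of the analytic polynomials with respect to the (quasi-)norm $$\|f\|_{A^p_\alpha}:=\Big(\int_{\mathbb D}|f(z)|^p(\alpha-1)(1-|z|^2)^{\alpha}\,d\mu(z)\Big)^{1/p},\qquad d\mu(z)=\frac{1}{(1-|z|^2)^2}\,\frac{dx\,dy}{\pi}\quad(z=x+iy),$$ and, by convention, $A^p_1=H^p$ with $\|f\|_{A^p_1}=\|f\|_{H^p}$. Suppose that for some $0<p_0<\infty$, some $1\le\alpha<\infty$ and some constant $C_\alpha\ge 0$ the inequality $$\|f\|_{A^{p_0\alpha}_{\alpha}}\le C_\alpha^{2/p_0}\,\|f\|_{H^{p_0}}$$ holds for every $f\in H^{p_0}$. Then, for every $0<p<\infty$, every positive integer $k$ and every $f\in H^p$, the function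 $f$ belongs to $A^{kp\alpha}_{k\alpha}$ and $$\|f\|_{A^{kp\alpha}_{k\alpha}}\le C_\alpha^{2/p}\,\|f\|_{H^p}.$$ In particular, for every $0<p<\infty$, every positive integer $k$ and every $f\in H^p$, the function $f$ belongs to $A^{kp}_k$ and $$\|f\|_{A^{kp}_k}\le\|f\|_{H^p}.$$ -/

import Mathlib

open MeasureTheory
open scoped ENNReal NNReal

noncomputable section

/-- The (quasi-)norm of the Hardy space `H^p` of the unit disc, with values in `[0, ∞]`: the
supremum over `0 < r < 1` of the `L^p` means of `f` over the circle of radius `r`, with respect to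
the normalized measure `dθ / 2π`. -/
def hardyNorm (p : ℝ) (f : ℂ → ℂ) : ℝ≥0∞ :=
  ⨆ r ∈ Set.Ioo (0 : ℝ) 1,
    (∫⁻ θ in Set.Ioc 0 (2 * Real.pi),
      ‖f (r * Complex.exp (θ * Complex.I))‖ₑ ^ p * ENNReal.ofReal (1 / (2 * Real.pi))) ^ (1 / p)

/-- `f` belongs to `H^p`: it is analytic in the unit disc and has finite `H^p` norm. The values of
`f` outside the open unit disc are irrelevant. -/
def MemHardy (p : ℝ) (f : ℂ → ℂ) : Prop :=
  AnalyticOnNhd ℂ f (Metric.ball 0 1) ∧ hardyNorm p f < ∞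

/-- The Möbius invariant measure `dμ(z) = (1 - |z|²)⁻² dx dy / π` of the unit disc. -/
def mobiusMeasure : Measure ℂ :=
  (volume.restrict (Metric.ball (0 : ℂ) 1)).withDensity
    fun z => ENNReal.ofReal (1 / (1 - ‖z‖ ^ 2) ^ 2 / Real.pi)

/-- The (quasi-)norm of the Bergman space `A^p_α` of the unit disc, with values in `[0, ∞]`. It is
given by the weighted area integral for `α > 1`; by convention `A^p_1 = H^p`.
It is only used for `α ≥ 1`. -/
def bergmanNorm (p α : ℝ) (f : ℂ → ℂ) : ℝ≥0∞ :=
  open Classical in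
  if α = 1 then hardyNorm p f
  else (∫⁻ z in Metric.ball (0 : ℂ) 1,
    ‖f z‖ₑ ^ p * ENNReal.ofReal ((α - 1) * (1 - ‖z‖ ^ 2) ^ α) ∂mobiusMeasure) ^ (1 / p)

/-- `f` belongs to `A^p_α`: for `α > 1`, it is analytic in the unit disc and lies in the closure of
the analytic polynomials with respect to the `A^p_α` (quasi-)norm; by convention `A^p_1 = H^p`. -/
def MemBergman (p α : ℝ) (f : ℂ → ℂ) : Prop :=
  (α = 1 ∧ MemHardy p f) ∨
  (α ≠ 1 ∧ AnalyticOnNhd ℂ f (Metric.ball 0 1) ∧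
    ∀ ε : ℝ≥0∞, 0 < ε → ∃ P : Polynomial ℂ, bergmanNorm p α (fun z => f z - P.eval z) < ε)

end

/-! Two facts carry the proof. First, multiplication is contractive from `A²_α × A²_β` to `A²_{α+β}`
(`bergmanNorm_two_mul_le`). The squared norm of `∑ aₙ zⁿ` in `A²_α` is `∑ |aₙ|² / cₙ(α)`, where `∑
cₙ(α) xⁿ = (1 - x)⁻ᵅ`. Since `(1 - x)⁻ᵅ (1 - x)⁻ᵝ = (1 - x)⁻⁽ᵅ⁺ᵝ⁾`, contractivity is Cauchy–Schwarz
on each coefficient of the Cauchy product.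

Second, a zero-free function `e^h` has all real powers. So `G = e^{(p/p₀)h}` satisfies `|G|^{p₀} =
|e^h|^p`, and the hypothesis for `p₀` becomes a bound on `u = e^{(pα/2)h}` in `A²_α`. Contractivity
gives `‖u^k‖² ≤ ‖u‖^{2k}`, with the left norm in `A²_{kα}` and the right one in `A²_α`. As `|u^k|² =
|e^h|^{kpα}`, this is the desired inequality for `e^h`.

To reach general `f`, dilate so that `f` is analytic on the closed disc. If `f` is not zero, it has
finitely many zeros there, and replacing each factor `z - u` by `1 - ū z` increases the modulus
inside, preserves it on the circle, and leaves no zeros in the open disc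
(`AnalyticOnNhd.exists_exp_majorant`). Fatou's lemma then removes the dilation.

Membership in the closure of the polynomials follows from the finite norm: dilations of `f` converge
to `f`, and each of them is a uniform limit of polynomials on the disc. -/

open Filter Topology Set Metric Finset.HasAntidiagonal
open scoped ComplexConjugate

/-! ### Binomial coefficients and the weighted Cauchy product inequality. -/

/-- The `n`-th Taylor coefficient of `(1 - x)⁻ᵅ`, the reciprocal of the squared `A²_α` norm of
`zⁿ`. -/
noncomputable def kernelCoeff (α : ℝ) (n : ℕ) : ℝ :=
  Real.Gamma (n + α) / (n.factorial * Real.Gamma α)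

lemma kernelCoeff_pos {α : ℝ} (hα : 0 < α) (n : ℕ) : 0 < kernelCoeff α n := by
  have h1 : 0 < Real.Gamma (n + α) := Real.Gamma_pos_of_pos (by positivity)
  have h2 : 0 < Real.Gamma α := Real.Gamma_pos_of_pos hα
  unfold kernelCoeff
  positivity

lemma kernelCoeff_zero {α : ℝ} (hα : 0 < α) : kernelCoeff α 0 = 1 := by
  have h2 : 0 < Real.Gamma α := Real.Gamma_pos_of_pos hα
  simp [kernelCoeff, h2.ne']

lemma kernelCoeff_one (n : ℕ) : kernelCoeff 1 n = 1 := by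
  simp [kernelCoeff, Real.Gamma_nat_eq_factorial, Nat.factorial_ne_zero]

/-- Coefficient form of the differential equation `(1 - x) y' = α y` of `y = (1 - x)⁻ᵅ`. -/
lemma succ_mul_kernelCoeff_succ {α : ℝ} (hα : 0 < α) (n : ℕ) :
    ((n : ℝ) + 1) * kernelCoeff α (n + 1) = (n + α) * kernelCoeff α n := by
  have h2 : 0 < Real.Gamma α := Real.Gamma_pos_of_pos hα
  have h3 : (0 : ℝ) < n.factorial := by positivity
  have h : Real.Gamma ((n + 1 : ℕ) + α) = (n + α) * Real.Gamma (n + α) := by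
    rw [← Real.Gamma_add_one (by positivity)]
    congr 1
    push_cast
    ring
  rw [kernelCoeff, h, Nat.factorial_succ, kernelCoeff]
  push_cast
  field_simp

/-- Coefficient form of `(1 - x)⁻ᵅ (1 - x)⁻ᵝ = (1 - x)⁻⁽ᵅ⁺ᵝ⁾`. In the induction, the factor `n + 1 =
i + j` is split as in the Leibniz rule and the recurrence is applied to each half. -/
lemma sum_antidiagonal_kernelCoeff {α β : ℝ} (hα : 0 < α) (hβ : 0 < β) (n : ℕ) :
    ∑ ij ∈ antidiagonal n, kernelCoeff α ij.1 * kernelCoeff β ij.2 = kernelCoeff (α + β) n := by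
  induction n with
  | zero => simp [kernelCoeff_zero, hα, hβ, add_pos]
  | succ n ih =>
    have hn : ((n : ℝ) + 1) ≠ 0 := by positivity
    refine mul_left_cancel₀ hn ?_
    rw [succ_mul_kernelCoeff_succ (add_pos hα hβ), ← ih, Finset.mul_sum, Finset.mul_sum]
    have e1 : ∑ ij ∈ antidiagonal (n + 1),
        ((ij.1 : ℝ) * kernelCoeff α ij.1) * kernelCoeff β ij.2 =
        ∑ ij ∈ antidiagonal n, (ij.1 + α) * kernelCoeff α ij.1 * kernelCoeff β ij.2 := by
      rw [Finset.Nat.sum_antidiagonal_succ]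
      simp [succ_mul_kernelCoeff_succ hα]
    have e2 : ∑ ij ∈ antidiagonal (n + 1),
        kernelCoeff α ij.1 * ((ij.2 : ℝ) * kernelCoeff β ij.2) =
        ∑ ij ∈ antidiagonal n, kernelCoeff α ij.1 * ((ij.2 + β) * kernelCoeff β ij.2) := by
      rw [Finset.Nat.sum_antidiagonal_succ']
      simp [succ_mul_kernelCoeff_succ hβ]
    calc _ = ∑ ij ∈ antidiagonal (n + 1),
          (((ij.1 : ℝ) * kernelCoeff α ij.1) * kernelCoeff β ij.2 +
            kernelCoeff α ij.1 * ((ij.2 : ℝ) * kernelCoeff β ij.2)) := by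
          refine Finset.sum_congr rfl fun ij hij => ?_
          have : (ij.1 : ℝ) + ij.2 = n + 1 := by
            exact_mod_cast Finset.HasAntidiagonal.mem_antidiagonal.mp hij
          rw [← this]
          ring
      _ = _ := by
          rw [Finset.sum_add_distrib, e1, e2, ← Finset.sum_add_distrib]
          refine Finset.sum_congr rfl fun ij hij => ?_
          have : (ij.1 : ℝ) + ij.2 = n := by
            exact_mod_cast Finset.HasAntidiagonal.mem_antidiagonal.mp hij
          rw [← this]
          ring

/-- The squared norm of the power series with coefficients `a` in `A²_α`. -/
noncomputable def coeffNorm (α : ℝ) (a : ℕ → ℂ) : ℝ≥0∞ :=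
  ∑' n, ‖a n‖ₑ ^ 2 * ENNReal.ofReal (kernelCoeff α n)⁻¹

/-- The coefficients of the Cauchy product of two power series. -/
noncomputable def cauchyProduct (a b : ℕ → ℂ) (n : ℕ) : ℂ :=
  ∑ ij ∈ antidiagonal n, a ij.1 * b ij.2

lemma ENNReal.tsum_mul_tsum_eq_tsum_sum_antidiagonal (f g : ℕ → ℝ≥0∞) :
    (∑' n, f n) * ∑' n, g n = ∑' n, ∑ ij ∈ antidiagonal n, f ij.1 * g ij.2 := by
  calc (∑' n, f n) * ∑' n, g n = ∑' p : ℕ × ℕ, f p.1 * g p.2 := by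
        rw [ENNReal.tsum_prod', ← ENNReal.tsum_mul_right]
        simp_rw [ENNReal.tsum_mul_left]
    _ = ∑' p : (Σ n : ℕ, antidiagonal n), f (p.2 : ℕ × ℕ).1 * g (p.2 : ℕ × ℕ).2 :=
        (Equiv.tsum_eq Finset.HasAntidiagonal.sigmaAntidiagonalEquivProd
          (fun p : ℕ × ℕ => f p.1 * g p.2)).symm
    _ = _ := by
        rw [ENNReal.tsum_sigma']
        refine tsum_congr fun n => ?_
        rw [tsum_fintype, Finset.sum_coe_sort (antidiagonal n) (fun ij => f ij.1 * g ij.2)]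

/-- Cauchy–Schwarz in each degree `n`, with weights `cᵢ(α) cⱼ(β)`, whose sum over `i + j = n` is
exactly `cₙ(α + β)`; hence the constant is 1. -/
lemma coeffNorm_cauchyProduct_le {α β : ℝ} (hα : 0 < α) (hβ : 0 < β) (a b : ℕ → ℂ) :
    coeffNorm (α + β) (cauchyProduct a b) ≤ coeffNorm α a * coeffNorm β b := by
  rw [coeffNorm, coeffNorm, coeffNorm, ENNReal.tsum_mul_tsum_eq_tsum_sum_antidiagonal]
  refine ENNReal.tsum_le_tsum fun n => ?_
  have key : ‖cauchyProduct a b n‖ ^ 2 * (kernelCoeff (α + β) n)⁻¹ ≤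
      ∑ ij ∈ antidiagonal n, (‖a ij.1‖ ^ 2 * (kernelCoeff α ij.1)⁻¹) *
        (‖b ij.2‖ ^ 2 * (kernelCoeff β ij.2)⁻¹) := by
    calc ‖cauchyProduct a b n‖ ^ 2 * (kernelCoeff (α + β) n)⁻¹
        ≤ (∑ ij ∈ antidiagonal n, ‖a ij.1‖ * ‖b ij.2‖) ^ 2 /
          ∑ ij ∈ antidiagonal n, kernelCoeff α ij.1 * kernelCoeff β ij.2 := by
          rw [sum_antidiagonal_kernelCoeff hα hβ, div_eq_mul_inv]
          have := kernelCoeff_pos (add_pos hα hβ) n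
          gcongr
          refine (norm_sum_le _ _).trans (le_of_eq ?_)
          simp
      _ ≤ ∑ ij ∈ antidiagonal n, (‖a ij.1‖ * ‖b ij.2‖) ^ 2 /
            (kernelCoeff α ij.1 * kernelCoeff β ij.2) :=
          Finset.sq_sum_div_le_sum_sq_div _ _ fun ij _ =>
            mul_pos (kernelCoeff_pos hα _) (kernelCoeff_pos hβ _)
      _ = _ := by
          refine Finset.sum_congr rfl fun ij _ => ?_
          rw [div_eq_mul_inv, mul_inv]
          ring
  have conv : ∀ (x : ℂ) (c : ℝ), ‖x‖ₑ ^ 2 * ENNReal.ofReal c = ENNReal.ofReal (‖x‖ ^ 2 * c) := by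
    intro x c
    rw [ENNReal.ofReal_mul (by positivity), ENNReal.ofReal_pow (norm_nonneg _), ofReal_norm]
  simp_rw [conv]
  refine (ENNReal.ofReal_le_ofReal key).trans (le_of_eq ?_)
  have p1 := fun i => (kernelCoeff_pos hα i).le
  have p2 := fun i => (kernelCoeff_pos hβ i).le
  rw [ENNReal.ofReal_sum_of_nonneg]
  · refine Finset.sum_congr rfl fun ij _ => ?_
    rw [ENNReal.ofReal_mul (mul_nonneg (by positivity) (inv_nonneg.2 (p1 _)))]
  · intro ij _
    exact mul_nonneg (mul_nonneg (by positivity) (inv_nonneg.2 (p1 _)))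
      (mul_nonneg (by positivity) (inv_nonneg.2 (p2 _)))

/-! ### Power series in the disc. -/

/-- `u` is the sum of the power series with coefficients `a` in the open unit disc. -/
def HasDiscSeries (u : ℂ → ℂ) (a : ℕ → ℂ) : Prop :=
  ∀ z, ‖z‖ < 1 → HasSum (fun n => a n * z ^ n) (u z)

lemma AnalyticOnNhd.exists_hasDiscSeries {u : ℂ → ℂ} (hu : AnalyticOnNhd ℂ u (ball 0 1)) :
    ∃ a, HasDiscSeries u a := by
  refine ⟨fun n => (n.factorial : ℂ)⁻¹ * iteratedDeriv n u 0, fun z hz => ?_⟩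
  have := Complex.hasSum_taylorSeries_on_ball hu.differentiableOn
    (show z ∈ ball (0 : ℂ) 1 by simpa using hz)
  simp only [sub_zero, smul_eq_mul] at this
  simpa only [mul_assoc, mul_comm (z ^ _)] using this

lemma HasDiscSeries.mul {u v : ℂ → ℂ} {a b : ℕ → ℂ} (hu : HasDiscSeries u a)
    (hv : HasDiscSeries v b) : HasDiscSeries (fun z => u z * v z) (cauchyProduct a b) := by
  intro z hz
  have h1 := (hu z hz).summable.norm
  have h2 := (hv z hz).summable.norm
  have e : ∀ n, ∑ kl ∈ antidiagonal n, (a kl.1 * z ^ kl.1) * (b kl.2 * z ^ kl.2) =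
      cauchyProduct a b n * z ^ n := by
    intro n
    rw [cauchyProduct, Finset.sum_mul]
    refine Finset.sum_congr rfl fun ij hij => ?_
    rw [← Finset.HasAntidiagonal.mem_antidiagonal.mp hij, pow_add]
    ring
  have h3 := (summable_norm_sum_mul_antidiagonal_of_summable_norm h1 h2).of_norm
  have h4 := tsum_mul_tsum_eq_tsum_sum_antidiagonal_of_summable_norm h1 h2
  rw [(hu z hz).tsum_eq, (hv z hz).tsum_eq] at h4
  simp only [e] at h3 h4
  change HasSum _ (u z * v z)
  rw [h4]
  exact h3.hasSum

/-! ### Circle means and Parseval's identity. -/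

/-- The mean of `|f|^q` over the circle of radius `r`. -/
noncomputable def circMean (q : ℝ) (f : ℂ → ℂ) (r : ℝ) : ℝ≥0∞ :=
  ∫⁻ θ in Set.Ioc 0 (2 * Real.pi),
    ‖f (r * Complex.exp (θ * Complex.I))‖ₑ ^ q * ENNReal.ofReal (1 / (2 * Real.pi))

lemma ENNReal.iSup_rpow {ι : Sort*} (f : ι → ℝ≥0∞) {q : ℝ} (hq : 0 < q) :
    (⨆ i, f i) ^ q = ⨆ i, f i ^ q :=
  (ENNReal.orderIsoRpow q hq).map_iSup f

lemma hardyNorm_rpow {q : ℝ} (hq : 0 < q) (f : ℂ → ℂ) :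
    hardyNorm q f ^ q = ⨆ r ∈ Ioo (0 : ℝ) 1, circMean q f r := by
  unfold hardyNorm circMean
  simp_rw [ENNReal.iSup_rpow _ hq, one_div, ENNReal.rpow_inv_rpow hq.ne']

/-- The exponents may differ, which is how a zero-free function is traded for one of its powers. -/
lemma circMean_congr {q q' r : ℝ} {f g : ℂ → ℂ}
    (h : ∀ z, ‖z‖ = |r| → ‖f z‖ₑ ^ q = ‖g z‖ₑ ^ q') : circMean q f r = circMean q' g r := by
  unfold circMean
  refine lintegral_congr fun θ => ?_
  rw [h _ (by simp [Complex.norm_exp_ofReal_mul_I])]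

lemma circMean_mono {q q' r : ℝ} {f g : ℂ → ℂ}
    (h : ∀ z, ‖z‖ = |r| → ‖f z‖ₑ ^ q ≤ ‖g z‖ₑ ^ q') : circMean q f r ≤ circMean q' g r := by
  unfold circMean
  refine lintegral_mono fun θ => ?_
  gcongr
  exact h _ (by simp [Complex.norm_exp_ofReal_mul_I])

lemma circMean_comp_mul (q : ℝ) (f : ℂ → ℂ) (ρ r : ℝ) :
    circMean q (fun z => f (ρ * z)) r = circMean q f (ρ * r) := by
  unfold circMean
  simp [mul_assoc]

lemma lintegral_circle_const (c : ℝ≥0∞) :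
    ∫⁻ _ in Set.Ioc 0 (2 * Real.pi), c * ENNReal.ofReal (1 / (2 * Real.pi)) = c := by
  have h : (0 : ℝ) < 2 * Real.pi := by positivity
  rw [lintegral_const, Measure.restrict_apply_univ, Real.volume_Ioc, sub_zero, mul_assoc,
    ← ENNReal.ofReal_mul (by positivity), one_div, inv_mul_cancel₀ h.ne', ENNReal.ofReal_one,
    mul_one]

lemma circMean_le_of_le {q r : ℝ} {f : ℂ → ℂ} {c : ℝ≥0∞}
    (h : ∀ z, ‖z‖ = |r| → ‖f z‖ₑ ^ q ≤ c) : circMean q f r ≤ c := by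
  rw [← lintegral_circle_const c]
  unfold circMean
  refine lintegral_mono fun θ => ?_
  gcongr
  exact h _ (by simp [Complex.norm_exp_ofReal_mul_I])

lemma continuous_circle_param (r : ℝ) :
    Continuous fun θ : ℝ => (r : ℂ) * Complex.exp (θ * Complex.I) := by
  fun_prop

/-- Circle means pass to the limit under bounded pointwise convergence. -/
lemma tendsto_circMean {q : ℝ} (hq : 0 < q) {F : ℕ → ℂ → ℂ} {f : ℂ → ℂ} {s : ℕ → ℝ} {r : ℝ}
    (hF : ∀ n, Continuous fun θ : ℝ => F n (s n * Complex.exp (θ * Complex.I)))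
    {c : ℝ} (hc : ∀ n, ∀ θ : ℝ, ‖F n (s n * Complex.exp (θ * Complex.I))‖ ≤ c)
    (hlim : ∀ θ : ℝ, Tendsto (fun n => F n (s n * Complex.exp (θ * Complex.I))) atTop
      (𝓝 (f (r * Complex.exp (θ * Complex.I))))) :
    Tendsto (fun n => circMean q (F n) (s n)) atTop (𝓝 (circMean q f r)) := by
  unfold circMean
  refine tendsto_lintegral_of_dominated_convergence
    (fun _ => ENNReal.ofReal c ^ q * ENNReal.ofReal (1 / (2 * Real.pi))) (fun n => ?_)
    (fun n => ?_) ?_ ?_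
  · exact (((hF n).measurable.enorm).pow_const q).mul_const _
  · refine ae_of_all _ fun θ => ?_
    dsimp only
    gcongr
    rw [← ofReal_norm]
    exact ENNReal.ofReal_le_ofReal (hc n θ)
  · rw [lintegral_circle_const]
    exact ENNReal.rpow_ne_top_of_nonneg hq.le ENNReal.ofReal_ne_top
  · refine ae_of_all _ fun θ => ?_
    refine ENNReal.Tendsto.mul_const ?_ (Or.inr ENNReal.ofReal_ne_top)
    exact ((ENNReal.continuous_rpow_const (y := q)).tendsto _).comp
      ((continuous_enorm.tendsto _).comp (hlim θ))

lemma circMean_two_polynomial (P : Polynomial ℂ) :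
    circMean 2 (fun z => P.eval z) 1 = ∑ i ∈ P.support, ‖P.coeff i‖ₑ ^ 2 := by
  have h : (0 : ℝ) < 2 * Real.pi := by positivity
  have hc : Continuous fun θ : ℝ => ‖P.eval (circleMap 0 1 θ)‖ ^ 2 :=
    (P.continuous.comp (continuous_circleMap 0 1)).norm.pow 2
  have e : ∑ i ∈ P.support, ‖P.coeff i‖ₑ ^ 2 =
      ENNReal.ofReal (∑ i ∈ P.support, ‖P.coeff i‖ ^ 2) := by
    rw [ENNReal.ofReal_sum_of_nonneg (fun i _ => by positivity)]
    refine Finset.sum_congr rfl fun i _ => ?_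
    rw [ENNReal.ofReal_pow (norm_nonneg _), ofReal_norm]
  rw [e, Polynomial.sum_sq_norm_coeff_eq_circleAverage, Real.circleAverage, smul_eq_mul,
    ENNReal.ofReal_mul (by positivity), intervalIntegral.integral_of_le h.le,
    ofReal_integral_eq_lintegral_ofReal, circMean, lintegral_mul_const, mul_comm, one_div]
  · congr 1
    refine lintegral_congr fun θ => ?_
    rw [ENNReal.ofReal_pow (norm_nonneg _), ofReal_norm, ENNReal.rpow_two]
    simp [circleMap]
  · exact ((P.continuous.comp (continuous_circle_param 1)).measurable.enorm).pow_const _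
  · exact hc.integrableOn_Ioc
  · exact ae_of_all _ fun θ => by positivity

/-- Parseval's identity on the circle of radius `r`. -/
lemma HasDiscSeries.circMean_two {u : ℂ → ℂ} {a : ℕ → ℂ} (h : HasDiscSeries u a) {r : ℝ}
    (hr : 0 ≤ r) (hr1 : r < 1) :
    circMean 2 u r = ∑' n, ‖a n‖ₑ ^ 2 * ENNReal.ofReal r ^ (2 * n) := by
  -- The truncated series of `u (r z)`: the radius is absorbed in the coefficients, so that Parseval
  -- for polynomials on the unit circle applies.
  set P : ℕ → Polynomial ℂ := fun N =>
    ∑ n ∈ Finset.range N, Polynomial.monomial n (a n * (r : ℂ) ^ n) with hP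
  have hcoeff : ∀ N i, (P N).coeff i = if i < N then a i * (r : ℂ) ^ i else 0 := by
    intro N i
    simp [hP, Polynomial.coeff_monomial]
  have heval : ∀ N z, (P N).eval z = ∑ n ∈ Finset.range N, a n * (r * z) ^ n := by
    intro N z
    simp [hP, Polynomial.eval_finsetSum, mul_pow, mul_assoc]
  have hsum : Summable fun n => ‖a n * (r : ℂ) ^ n‖ :=
    (h r (by simpa [abs_of_nonneg hr] using hr1)).summable.norm
  have h1 : Tendsto (fun N => circMean 2 (fun z => (P N).eval z) 1) atTop
      (𝓝 (circMean 2 u r)) := by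
    refine tendsto_circMean (s := fun _ => 1) two_pos (c := ∑' n, ‖a n * (r : ℂ) ^ n‖)
      (fun N => (P N).continuous.comp (continuous_circle_param 1)) (fun N θ => ?_) (fun θ => ?_)
    · rw [heval]
      refine (norm_sum_le _ _).trans (le_trans (le_of_eq ?_)
        (hsum.sum_le_tsum (Finset.range N) (fun _ _ => norm_nonneg _)))
      refine Finset.sum_congr rfl fun n _ => ?_
      simp [Complex.norm_exp_ofReal_mul_I]
    · simp only [heval]
      have := (h (r * Complex.exp (θ * Complex.I))
        (by simpa [Complex.norm_exp_ofReal_mul_I, abs_of_nonneg hr] using hr1)).tendsto_sum_nat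
      simpa using this
  have h2 : Tendsto (fun N => circMean 2 (fun z => (P N).eval z) 1) atTop
      (𝓝 (∑' n, ‖a n‖ₑ ^ 2 * ENNReal.ofReal r ^ (2 * n))) := by
    have e : ∀ N, circMean 2 (fun z => (P N).eval z) 1 =
        ∑ n ∈ Finset.range N, ‖a n‖ₑ ^ 2 * ENNReal.ofReal r ^ (2 * n) := by
      intro N
      have hs : (P N).support ⊆ Finset.range N := by
        intro i hi
        by_contra hcon
        rw [Polynomial.mem_support_iff, hcoeff, if_neg (by simpa using hcon)] at hi
        exact hi rfl
      rw [circMean_two_polynomial, Finset.sum_subset hs]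
      · refine Finset.sum_congr rfl fun i hi => ?_
        rw [hcoeff, if_pos (Finset.mem_range.mp hi), enorm_mul, mul_pow, enorm_pow, ← pow_mul,
          mul_comm i 2]
        congr 2
        rw [← ofReal_norm, Complex.norm_of_nonneg hr]
      · intro i _ hi
        rw [Polynomial.notMem_support_iff.mp hi]
        simp
    simp only [e]
    exact ENNReal.tendsto_nat_tsum _
  exact tendsto_nhds_unique h1 h2

lemma HasDiscSeries.circMean_two_mono {u : ℂ → ℂ} {a : ℕ → ℂ} (h : HasDiscSeries u a) {r s : ℝ}
    (hr : 0 ≤ r) (hrs : r ≤ s) (hs : s < 1) : circMean 2 u r ≤ circMean 2 u s := by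
  rw [h.circMean_two hr (hrs.trans_lt hs), h.circMean_two (hr.trans hrs) hs]
  refine ENNReal.tsum_le_tsum fun n => ?_
  gcongr

/-! ### The area integral in polar coordinates. -/

/-- Both intervals are a full period up to a null set. The first is the range of
`Complex.polarCoord`, the second that of the circle means. -/
lemma lintegral_Ioo_neg_pi_pi_circle (H : ℂ → ℝ≥0∞) :
    ∫⁻ θ in Ioo (-Real.pi) Real.pi, H (Complex.exp (θ * Complex.I)) =
      ∫⁻ θ in Ioc 0 (2 * Real.pi), H (Complex.exp (θ * Complex.I)) := by
  have h : (0 : ℝ) < 2 * Real.pi := by positivity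
  have := Fact.mk h
  have key : ∀ t : ℝ, ∫⁻ θ in Ioc t (t + 2 * Real.pi), H (Complex.exp (θ * Complex.I)) =
      ∫⁻ b : AddCircle (2 * Real.pi), H (b.toCircle : ℂ) := by
    intro t
    rw [← AddCircle.lintegral_preimage (2 * Real.pi) t]
    refine lintegral_congr fun θ => ?_
    rw [AddCircle.toCircle_apply_mk, Circle.coe_exp]
    congr 3
    push_cast
    field_simp
  have h1 := key (-Real.pi)
  have h2 := key 0
  rw [zero_add] at h2
  rw [h2, ← h1, restrict_Ioo_eq_restrict_Ioc]
  congr 3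
  ring

/-- Integration over the unit disc in polar coordinates. -/
lemma lintegral_ball_polar {H : ℂ → ℝ≥0∞} (hH : Measurable H) :
    ∫⁻ z in ball (0 : ℂ) 1, H z = ∫⁻ r in Ioo (0 : ℝ) 1, ENNReal.ofReal r *
      ∫⁻ θ in Ioc 0 (2 * Real.pi), H (r * Complex.exp (θ * Complex.I)) := by
  have hexp : ∀ p : ℝ × ℝ, Complex.polarCoord.symm p = p.1 * Complex.exp (p.2 * Complex.I) := by
    intro p
    rw [Complex.polarCoord_symm_apply, Complex.exp_mul_I]
    push_cast
    ring
  have hm : Measurable ((ball (0 : ℂ) 1).indicator H) := hH.indicator measurableSet_ball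
  rw [← lintegral_indicator measurableSet_ball, ← Complex.lintegral_comp_polarCoord_symm,
    polarCoord_target, Measure.volume_eq_prod, ← Measure.prod_restrict, lintegral_prod]
  · simp only [hexp, smul_eq_mul]
    rw [← lintegral_indicator measurableSet_Ioi, ← lintegral_indicator measurableSet_Ioo]
    refine lintegral_congr fun r => ?_
    by_cases hr : r ∈ Ioo (0 : ℝ) 1
    · rw [indicator_of_mem (show r ∈ Ioi (0 : ℝ) from hr.1), indicator_of_mem hr,
        lintegral_const_mul' _ _ ENNReal.ofReal_ne_top,
        ← lintegral_Ioo_neg_pi_pi_circle (fun w => H (r * w))]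
      congr 1
      refine lintegral_congr fun θ => ?_
      rw [indicator_of_mem]
      simpa [Complex.norm_exp_ofReal_mul_I, abs_of_pos hr.1] using hr.2
    · rw [indicator_of_notMem hr]
      by_cases hr0 : r ∈ Ioi (0 : ℝ)
      · rw [indicator_of_mem hr0]
        refine (lintegral_congr fun θ => ?_).trans lintegral_zero
        rw [indicator_of_notMem, mul_zero]
        have hr0' : 0 < r := hr0
        have : 1 ≤ r := by
          by_contra hcon
          exact hr ⟨hr0, not_le.mp hcon⟩
        simpa [Complex.norm_exp_ofReal_mul_I, abs_of_pos hr0'] using this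
      · rw [indicator_of_notMem hr0]
  · simp only [hexp, smul_eq_mul]
    refine Measurable.aemeasurable ?_
    refine Measurable.mul (by fun_prop) (hm.comp ?_)
    fun_prop

/-- The density in the radial variable of the weighted area measure of `A^q_β`. -/
noncomputable def radialWeight (β r : ℝ) : ℝ≥0∞ :=
  ENNReal.ofReal (2 * r * (β - 1) * (1 - r ^ 2) ^ (β - 2))

lemma measurable_radialWeight (β : ℝ) : Measurable (radialWeight β) := by
  unfold radialWeight
  fun_prop

/-- The weighted area integral defining the norm of `A^q_β` for `β > 1`. -/
noncomputable def bergmanIntegral (q β : ℝ) (f : ℂ → ℂ) : ℝ≥0∞ :=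
  ∫⁻ z in ball (0 : ℂ) 1,
    ‖f z‖ₑ ^ q * ENNReal.ofReal ((β - 1) * (1 - ‖z‖ ^ 2) ^ β) ∂mobiusMeasure

lemma bergmanIntegral_congr {q q' β : ℝ} {f g : ℂ → ℂ}
    (h : ∀ z, ‖z‖ < 1 → ‖f z‖ₑ ^ q = ‖g z‖ₑ ^ q') :
    bergmanIntegral q β f = bergmanIntegral q' β g := by
  refine setLIntegral_congr_fun measurableSet_ball fun z hz => ?_
  rw [h z (by simpa using hz)]

lemma measurable_density :
    Measurable fun z : ℂ => ENNReal.ofReal (1 / (1 - ‖z‖ ^ 2) ^ 2 / Real.pi) := by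
  fun_prop

lemma bergmanIntegral_eq_lintegral_circMean {q β : ℝ} (hβ : 1 < β) {f : ℂ → ℂ}
    (hf : ContinuousOn f (ball 0 1)) :
    bergmanIntegral q β f = ∫⁻ r in Ioo (0 : ℝ) 1, circMean q f r * radialWeight β r := by
  classical
  -- Nothing is known of `f` outside the disc; extending it by zero makes it measurable.
  set g : ℂ → ℂ := (ball (0 : ℂ) 1).piecewise f 0 with hg
  have hgm : Measurable g := hf.measurable_piecewise continuousOn_const measurableSet_ball
  have hfg : ∀ z, ‖z‖ < 1 → g z = f z := fun z hz => by
    rw [hg, piecewise_eq_of_mem _ _ _ (by simpa using hz)]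
  have e1 : bergmanIntegral q β f = bergmanIntegral q β g :=
    bergmanIntegral_congr fun z hz => by rw [hfg z hz]
  have e2 : ∀ r ∈ Ioo (0 : ℝ) 1, circMean q f r = circMean q g r := fun r hr =>
    circMean_congr fun z hz => by rw [hfg z (by rw [hz, abs_of_pos hr.1]; exact hr.2)]
  have hrestr : mobiusMeasure.restrict (ball 0 1) = (volume.restrict (ball (0 : ℂ) 1)).withDensity
      fun z => ENNReal.ofReal (1 / (1 - ‖z‖ ^ 2) ^ 2 / Real.pi) := by
    rw [mobiusMeasure, restrict_withDensity measurableSet_ball, Measure.restrict_restrict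
      measurableSet_ball, inter_self]
  have hmw : Measurable fun z : ℂ => ENNReal.ofReal ((β - 1) * (1 - ‖z‖ ^ 2) ^ β) := by fun_prop
  have hmeas : Measurable ((fun z : ℂ => ENNReal.ofReal (1 / (1 - ‖z‖ ^ 2) ^ 2 / Real.pi)) *
      fun z => ‖g z‖ₑ ^ q * ENNReal.ofReal ((β - 1) * (1 - ‖z‖ ^ 2) ^ β)) :=
    measurable_density.mul ((hgm.enorm.pow_const q).mul hmw)
  rw [e1, bergmanIntegral, hrestr,
    lintegral_withDensity_eq_lintegral_mul_non_measurable _ measurable_density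
      (ae_of_all _ fun _ => ENNReal.ofReal_lt_top), lintegral_ball_polar hmeas]
  refine setLIntegral_congr_fun measurableSet_Ioo fun r hr => ?_
  rw [e2 r hr, circMean, ← lintegral_const_mul' _ _ ENNReal.ofReal_ne_top,
    ← lintegral_mul_const' _ _ (by exact ENNReal.ofReal_ne_top)]
  refine lintegral_congr fun θ => ?_
  have hn : ‖(r : ℂ) * Complex.exp (θ * Complex.I)‖ = r := by
    simp [Complex.norm_exp_ofReal_mul_I, abs_of_pos hr.1]
  have hr2 : 0 < 1 - r ^ 2 := by nlinarith [hr.1, hr.2]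
  have hβ' : 0 < β - 1 := by linarith
  have hr0 := hr.1
  rw [Pi.mul_apply, hn, radialWeight, mul_assoc (‖_‖ₑ ^ q), ← ENNReal.ofReal_mul (by positivity),
    mul_left_comm (ENNReal.ofReal (1 / (1 - r ^ 2) ^ 2 / Real.pi)), mul_left_comm, ← ENNReal.ofReal_mul (by positivity),
    ← ENNReal.ofReal_mul (by positivity)]
  congr 2
  rw [Real.rpow_sub hr2, Real.rpow_two]
  field_simp

/-- The even moments of the radial weight. -/
lemma lintegral_pow_mul_radialWeight {β : ℝ} (hβ : 1 < β) (n : ℕ) :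
    ∫⁻ r in Ioo (0 : ℝ) 1, ENNReal.ofReal r ^ (2 * n) * radialWeight β r =
      ENNReal.ofReal (kernelCoeff β n)⁻¹ := by
  have hβ' : 0 < β - 1 := by linarith
  have hn : (0 : ℝ) < n + 1 := by positivity
  have hb := ProbabilityTheory.beta_pos hn hβ'
  have himg : (fun r : ℝ => r ^ 2) '' Ioo 0 1 = Ioo 0 1 := by
    ext t
    constructor
    · rintro ⟨r, hr, rfl⟩
      exact ⟨by have := hr.1; positivity, by nlinarith [hr.1, hr.2]⟩
    · intro ht
      refine ⟨√t, ⟨Real.sqrt_pos.2 ht.1, ?_⟩, Real.sq_sqrt ht.1.le⟩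
      rw [Real.sqrt_lt' one_pos]
      simpa using ht.2
  -- The substitution `t = r²` turns the moment into the Beta integral `B(n + 1, β - 1)`, evaluated
  -- below through the total mass of the Beta distribution.
  have hsub := lintegral_image_eq_lintegral_abs_deriv_mul (s := Ioo (0 : ℝ) 1)
    (f := fun r => r ^ 2) (f' := fun r => 2 * r) measurableSet_Ioo
    (fun r _ => by simpa using (hasDerivAt_pow 2 r).hasDerivWithinAt)
    (fun r hr s hs h => by
      simpa using (pow_left_inj₀ hr.1.le hs.1.le two_ne_zero).1 h)
    (fun t => ENNReal.ofReal ((β - 1) * (t ^ ((n + 1 : ℝ) - 1) * (1 - t) ^ (β - 1 - 1))))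
  rw [himg] at hsub
  have e1 : ∫⁻ r in Ioo (0 : ℝ) 1, ENNReal.ofReal r ^ (2 * n) * radialWeight β r =
      ∫⁻ t in Ioo (0 : ℝ) 1,
        ENNReal.ofReal ((β - 1) * (t ^ ((n + 1 : ℝ) - 1) * (1 - t) ^ (β - 1 - 1))) := by
    rw [hsub]
    refine setLIntegral_congr_fun measurableSet_Ioo fun r hr => ?_
    have hr0 := hr.1
    rw [radialWeight, ← ENNReal.ofReal_pow hr0.le, ← ENNReal.ofReal_mul (by positivity),
      ← ENNReal.ofReal_mul (by positivity), abs_of_pos (by positivity), add_sub_cancel_right,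
      Real.rpow_natCast, ← pow_mul]
    congr 1
    rw [show β - 1 - 1 = β - 2 by ring]
    ring
  have e2 : ∫⁻ t in Ioo (0 : ℝ) 1,
        ENNReal.ofReal ((β - 1) * (t ^ ((n + 1 : ℝ) - 1) * (1 - t) ^ (β - 1 - 1))) =
      ENNReal.ofReal ((β - 1) * ProbabilityTheory.beta (n + 1) (β - 1)) * 1 := by
    rw [← ProbabilityTheory.lintegral_betaPDF_eq_one hn hβ', ProbabilityTheory.lintegral_betaPDF,
      ← lintegral_const_mul' _ _ ENNReal.ofReal_ne_top]
    refine setLIntegral_congr_fun measurableSet_Ioo fun t ht => ?_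
    rw [← ENNReal.ofReal_mul (by positivity)]
    congr 1
    field_simp
  rw [e1, e2, mul_one]
  congr 1
  have hG : Real.Gamma β = (β - 1) * Real.Gamma (β - 1) := by
    rw [← Real.Gamma_add_one hβ'.ne', sub_add_cancel]
  have h2 : 0 < Real.Gamma (β - 1) := Real.Gamma_pos_of_pos hβ'
  have h3 : 0 < Real.Gamma (n + β) := Real.Gamma_pos_of_pos (by positivity)
  rw [ProbabilityTheory.beta, kernelCoeff, Real.Gamma_nat_eq_factorial, hG,
    show (n : ℝ) + 1 + (β - 1) = n + β by ring]
  field_simp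

lemma lintegral_radialWeight {β : ℝ} (hβ : 1 < β) :
    ∫⁻ r in Ioo (0 : ℝ) 1, radialWeight β r = 1 := by
  simpa [kernelCoeff_zero (zero_lt_one.trans hβ)] using lintegral_pow_mul_radialWeight hβ 0

lemma HasDiscSeries.bergmanIntegral_two {u : ℂ → ℂ} {a : ℕ → ℂ} (h : HasDiscSeries u a)
    (hu : ContinuousOn u (ball 0 1)) {β : ℝ} (hβ : 1 < β) :
    bergmanIntegral 2 β u = coeffNorm β a := by
  rw [bergmanIntegral_eq_lintegral_circMean hβ hu, coeffNorm]
  have e : ∀ r ∈ Ioo (0 : ℝ) 1, circMean 2 u r * radialWeight β r =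
      ∑' n, ‖a n‖ₑ ^ 2 * (ENNReal.ofReal r ^ (2 * n) * radialWeight β r) := by
    intro r hr
    rw [h.circMean_two hr.1.le hr.2, ← ENNReal.tsum_mul_right]
    simp_rw [mul_assoc]
  rw [setLIntegral_congr_fun measurableSet_Ioo e, lintegral_tsum]
  · refine tsum_congr fun n => ?_
    rw [lintegral_const_mul', lintegral_pow_mul_radialWeight hβ]
    exact ENNReal.pow_ne_top enorm_ne_top
  · intro n
    have := measurable_radialWeight β
    fun_prop

/-! ### Norms as integrals and coefficient sums; contractive multiplication. -/

/-- The `q`-th power of the norm of `A^q_α`. -/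
lemma bergmanNorm_rpow {q α : ℝ} (hq : 0 < q) (hα : α ≠ 1) (f : ℂ → ℂ) :
    bergmanNorm q α f ^ q = bergmanIntegral q α f := by
  rw [bergmanNorm, if_neg hα, one_div, ENNReal.rpow_inv_rpow hq.ne', bergmanIntegral]

lemma bergmanNorm_one_rpow {q : ℝ} (hq : 0 < q) (f : ℂ → ℂ) :
    bergmanNorm q 1 f ^ q = ⨆ r ∈ Ioo (0 : ℝ) 1, circMean q f r := by
  rw [bergmanNorm, if_pos rfl, hardyNorm_rpow hq]

lemma bergmanNorm_rpow_congr {q q' α : ℝ} (hq : 0 < q) (hq' : 0 < q') {f g : ℂ → ℂ}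
    (h : ∀ z, ‖z‖ < 1 → ‖f z‖ₑ ^ q = ‖g z‖ₑ ^ q') :
    bergmanNorm q α f ^ q = bergmanNorm q' α g ^ q' := by
  by_cases hα : α = 1
  · subst hα
    rw [bergmanNorm_one_rpow hq, bergmanNorm_one_rpow hq']
    refine iSup_congr fun r => iSup_congr fun hr => circMean_congr fun z hz => h z ?_
    rw [hz, abs_of_pos hr.1]
    exact hr.2
  · rw [bergmanNorm_rpow hq hα, bergmanNorm_rpow hq' hα]
    exact bergmanIntegral_congr h

/-- The norm of `A²_α` in terms of power series coefficients. -/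
lemma HasDiscSeries.bergmanNorm_two {u : ℂ → ℂ} {a : ℕ → ℂ} (h : HasDiscSeries u a)
    (hu : ContinuousOn u (ball 0 1)) {α : ℝ} (hα : 1 ≤ α) :
    bergmanNorm 2 α u ^ (2 : ℝ) = coeffNorm α a := by
  rcases hα.eq_or_lt with rfl | hα
  · rw [bergmanNorm_one_rpow two_pos, coeffNorm]
    simp only [kernelCoeff_one, inv_one, ENNReal.ofReal_one, mul_one]
    refine le_antisymm (iSup₂_le fun r hr => ?_) ?_
    · rw [h.circMean_two hr.1.le hr.2]
      refine ENNReal.tsum_le_tsum fun n => mul_le_of_le_one_right' ?_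
      exact pow_le_one' (by simpa using hr.2.le) _
    -- Each finite partial sum is a limit as `r → 1` of quantities below the circle means, hence is
    -- at most their supremum.
    · rw [ENNReal.tsum_eq_iSup_sum]
      refine iSup_le fun s => ?_
      have hlim : Tendsto (fun r : ℝ => ∑ n ∈ s, ‖a n‖ₑ ^ 2 * ENNReal.ofReal r ^ (2 * n))
          (𝓝[<] 1) (𝓝 (∑ n ∈ s, ‖a n‖ₑ ^ 2)) := by
        refine tendsto_finsetSum _ fun n _ => ?_
        have : Tendsto (fun r : ℝ => ENNReal.ofReal r ^ (2 * n)) (𝓝[<] 1) (𝓝 1) := by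
          have h1 : Continuous fun r : ℝ => ENNReal.ofReal r ^ (2 * n) :=
            (ENNReal.continuous_pow _).comp ENNReal.continuous_ofReal
          simpa using (h1.tendsto 1).mono_left nhdsWithin_le_nhds
        simpa using ENNReal.Tendsto.const_mul this
          (Or.inr (ENNReal.pow_ne_top (n := 2) (enorm_ne_top (x := a n))))
      refine le_of_tendsto hlim ?_
      filter_upwards [Ioo_mem_nhdsLT (zero_lt_one' ℝ)] with r hr
      refine le_trans ?_ (le_iSup₂ (f := fun r _ => circMean 2 u r) r hr)
      rw [h.circMean_two hr.1.le hr.2]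
      exact ENNReal.sum_le_tsum s
  · rw [bergmanNorm_rpow two_pos hα.ne', h.bergmanIntegral_two hu hα]

/-- Contractivity of multiplication from `A²_α × A²_β` to `A²_{α+β}`. -/
lemma bergmanNorm_two_mul_le {u v : ℂ → ℂ} (hu : AnalyticOnNhd ℂ u (ball 0 1))
    (hv : AnalyticOnNhd ℂ v (ball 0 1)) {α β : ℝ} (hα : 1 ≤ α) (hβ : 1 ≤ β) :
    bergmanNorm 2 (α + β) (fun z => u z * v z) ^ (2 : ℝ) ≤
      bergmanNorm 2 α u ^ (2 : ℝ) * bergmanNorm 2 β v ^ (2 : ℝ) := by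
  obtain ⟨a, ha⟩ := hu.exists_hasDiscSeries
  obtain ⟨b, hb⟩ := hv.exists_hasDiscSeries
  rw [ha.bergmanNorm_two hu.continuousOn hα, hb.bergmanNorm_two hv.continuousOn hβ,
    (ha.mul hb).bergmanNorm_two (hu.continuousOn.mul hv.continuousOn) (by linarith)]
  exact coeffNorm_cauchyProduct_le (by linarith) (by linarith) a b

lemma bergmanNorm_two_pow_le {u : ℂ → ℂ} (hu : AnalyticOnNhd ℂ u (ball 0 1)) {α : ℝ}
    (hα : 1 ≤ α) {k : ℕ} (hk : 0 < k) :
    bergmanNorm 2 (k * α) (fun z => u z ^ k) ^ (2 : ℝ) ≤ (bergmanNorm 2 α u ^ (2 : ℝ)) ^ k := by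
  induction k, hk using Nat.le_induction with
  | base => simp
  | succ k hk ih =>
    have hk1 : (1 : ℝ) ≤ k := by exact_mod_cast hk
    have := bergmanNorm_two_mul_le (hu.pow k) hu (α := k * α) (β := α) (by nlinarith) hα
    rw [show ((k + 1 : ℕ) : ℝ) * α = k * α + α by push_cast; ring]
    simp only [pow_succ, Pi.pow_apply] at this ⊢
    exact this.trans (mul_le_mul_left ih _)

/-! ### Analytic logarithms and division by Blaschke products. -/

/-- If `F` is a primitive of `g'/g` on the disc, then `g e^{-F}` has zero derivative and is
constant; adding a constant to `F` gives the logarithm. -/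
lemma AnalyticOnNhd.exists_exp_eq {g : ℂ → ℂ} (hg : AnalyticOnNhd ℂ g (ball 0 1))
    (h0 : ∀ z ∈ ball (0 : ℂ) 1, g z ≠ 0) :
    ∃ h : ℂ → ℂ, AnalyticOnNhd ℂ h (ball 0 1) ∧
      ∀ z ∈ ball (0 : ℂ) 1, Complex.exp (h z) = g z := by
  obtain ⟨F, hF⟩ := ((hg.deriv.div hg h0).differentiableOn).isExactOn_ball
  have hFd : DifferentiableOn ℂ F (ball 0 1) := fun z hz =>
    (hF z hz).differentiableAt.differentiableWithinAt
  have hconst : ∀ z ∈ ball (0 : ℂ) 1,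
      g z * Complex.exp (-F z) = g 0 * Complex.exp (-F 0) := by
    intro z hz
    have hd : ∀ w ∈ ball (0 : ℂ) 1, HasDerivAt (fun w => g w * Complex.exp (-F w)) 0 w := by
      intro w hw
      have h1 := (hg w hw).differentiableAt.hasDerivAt
      have h2 := h1.mul (hF w hw).neg.cexp
      refine h2.congr_deriv ?_
      have hquot : g w * (deriv g w / g w) = deriv g w := mul_div_cancel₀ _ (h0 w hw)
      change deriv g w * Complex.exp (-F w) +
        g w * (Complex.exp (-F w) * -(deriv g w / g w)) = 0
      linear_combination -Complex.exp (-F w) * hquot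
    exact isOpen_ball.is_const_of_deriv_eq_zero (convex_ball _ _).isPreconnected
      (fun w hw => (hd w hw).differentiableAt.differentiableWithinAt)
      (fun w hw => (hd w hw).deriv) hz (mem_ball_self one_pos)
  refine ⟨fun z => F z + (Complex.log (g 0) - F 0), ?_, fun z hz => ?_⟩
  · exact (hFd.add_const _).analyticOnNhd isOpen_ball
  · rw [Complex.exp_add, Complex.exp_sub, Complex.exp_log (h0 0 (mem_ball_self one_pos))]
    have := hconst z hz
    rw [Complex.exp_neg, Complex.exp_neg] at this
    have e1 := Complex.exp_ne_zero (F z)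
    have e2 := Complex.exp_ne_zero (F 0)
    field_simp at this ⊢
    rw [this]

lemma normSq_one_sub_conj_mul_sub (u z : ℂ) :
    ‖1 - conj u * z‖ ^ 2 - ‖z - u‖ ^ 2 = (1 - ‖z‖ ^ 2) * (1 - ‖u‖ ^ 2) := by
  simp only [← Complex.normSq_eq_norm_sq, Complex.normSq_apply, Complex.sub_re, Complex.sub_im,
    Complex.mul_re, Complex.mul_im, Complex.conj_re, Complex.conj_im, Complex.one_re,
    Complex.one_im]
  ring

lemma norm_sub_le_norm_one_sub_conj_mul {u z : ℂ} (hu : ‖u‖ ≤ 1) (hz : ‖z‖ ≤ 1) :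
    ‖z - u‖ ≤ ‖1 - conj u * z‖ := by
  refine (sq_le_sq₀ (norm_nonneg _) (norm_nonneg _)).1 ?_
  have := normSq_one_sub_conj_mul_sub u z
  have : 0 ≤ (1 - ‖z‖ ^ 2) * (1 - ‖u‖ ^ 2) :=
    mul_nonneg (by nlinarith [norm_nonneg z]) (by nlinarith [norm_nonneg u])
  linarith

lemma norm_sub_eq_norm_one_sub_conj_mul {u z : ℂ} (hz : ‖z‖ = 1) :
    ‖z - u‖ = ‖1 - conj u * z‖ := by
  refine (sq_eq_sq₀ (norm_nonneg _) (norm_nonneg _)).1 ?_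
  have := normSq_one_sub_conj_mul_sub u z
  rw [hz] at this
  linarith

lemma one_sub_conj_mul_ne_zero {u z : ℂ} (hu : ‖u‖ ≤ 1) (hz : ‖z‖ < 1) :
    1 - conj u * z ≠ 0 := by
  intro h
  have h1 : ‖conj u * z‖ = 1 := by rw [← sub_eq_zero.mp h, norm_one]
  rw [norm_mul, RCLike.norm_conj] at h1
  nlinarith [norm_nonneg u, norm_nonneg z]

/-- The zeros of an analytic function on the closed disc are the zeros of a polynomial. -/
lemma AnalyticOnNhd.exists_eq_prod_mul {f : ℂ → ℂ} (hf : AnalyticOnNhd ℂ f (closedBall 0 1))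
    (h0 : ∃ z ∈ closedBall (0 : ℂ) 1, f z ≠ 0) :
    ∃ (S : Finset ℂ) (m : ℂ → ℕ) (φ : ℂ → ℂ), (∀ u ∈ S, ‖u‖ ≤ 1) ∧
      AnalyticOnNhd ℂ φ (closedBall 0 1) ∧ (∀ z ∈ closedBall (0 : ℂ) 1, φ z ≠ 0) ∧
      ∀ z ∈ closedBall (0 : ℂ) 1, f z = (∏ u ∈ S, (z - u) ^ m u) * φ z := by
  set D := MeromorphicOn.divisor f (closedBall 0 1) with hD
  have hfin : D.support.Finite := D.finiteSupport (isCompact_closedBall 0 1)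
  obtain ⟨z₀, hz₀, hfz₀⟩ := h0
  have hord₀ : meromorphicOrderAt f z₀ ≠ ⊤ := by
    rw [(hf z₀ hz₀).meromorphicOrderAt_eq, (hf z₀ hz₀).analyticOrderAt_eq_zero.2 hfz₀]
    simp
  obtain ⟨φ, hφ, hφ0, heq⟩ := hf.meromorphicOn.extract_zeros_poles
    (fun u => hf.meromorphicOn.meromorphicOrderAt_ne_top_of_isPreconnected
      (convex_closedBall _ _).isPreconnected hz₀ u.2 hord₀) hfin
  have hprod : ∀ z, (∏ᶠ u, (· - u) ^ D u) z = ∏ u ∈ hfin.toFinset, (z - u) ^ (D u).toNat := by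
    intro z
    rw [Function.FactorizedRational.finprod_eq_fun hfin]
    simp only
    rw [finprod_eq_prod_of_mulSupport_subset (s := hfin.toFinset)]
    · refine Finset.prod_congr rfl fun u _ => ?_
      rw [← zpow_natCast, Int.toNat_of_nonneg (MeromorphicOn.AnalyticOnNhd.divisor_nonneg hf u)]
    · intro u hu
      simp only [Finite.coe_toFinset, Function.mem_support]
      intro hcon
      simp [hcon] at hu
  refine ⟨hfin.toFinset, fun u => (D u).toNat, φ, fun u hu => ?_, hφ, fun z hz => hφ0 ⟨z, hz⟩, ?_⟩
  · simpa using D.supportWithinDomain (by simpa using hu)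
  have hpoly : AnalyticOnNhd ℂ (fun z : ℂ => ∏ u ∈ hfin.toFinset, (z - u) ^ (D u).toNat)
      univ := fun z _ => by fun_prop
  -- The factorization is only known off a discrete set. At an interior point it holds on a
  -- punctured neighbourhood, so the identity theorem gives it at the point; continuity then extends
  -- it to the boundary.
  have hball : EqOn f (fun z => (∏ u ∈ hfin.toFinset, (z - u) ^ (D u).toNat) * φ z)
      (ball 0 1) := by
    intro z hz
    have hz' := ball_subset_closedBall hz
    refine (((hf z hz').frequently_eq_iff_eventually_eq
      ((hpoly z (mem_univ _)).mul (hφ z hz'))).1 ?_).self_of_nhds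
    refine Eventually.frequently ?_
    have h1 := mem_codiscreteWithin.1 heq z hz'
    rw [disjoint_principal_right] at h1
    filter_upwards [h1, nhdsWithin_le_nhds (isOpen_ball.mem_nhds hz)] with w hw hwb
    have hw2 := not_not.1 fun hcon => hw ⟨ball_subset_closedBall hwb, hcon⟩
    have hw3 : f w = ((∏ᶠ u, (· - u) ^ D u) • φ) w := hw2
    rw [hw3, Pi.smul_apply', smul_eq_mul, hprod]
    rfl
  exact hball.of_subset_closure hf.continuousOn
    ((hpoly.mono (subset_univ _)).mul hφ).continuousOn ball_subset_closedBall
    (by rw [closure_ball _ one_ne_zero])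

/-- Division by the Blaschke product of the zeros in the disc. -/
lemma AnalyticOnNhd.exists_zeroFree_majorant {f : ℂ → ℂ}
    (hf : AnalyticOnNhd ℂ f (closedBall 0 1)) (h0 : ∃ z ∈ closedBall (0 : ℂ) 1, f z ≠ 0) :
    ∃ g : ℂ → ℂ, AnalyticOnNhd ℂ g (closedBall 0 1) ∧ (∀ z ∈ ball (0 : ℂ) 1, g z ≠ 0) ∧
      (∀ z, ‖z‖ ≤ 1 → ‖f z‖ ≤ ‖g z‖) ∧ ∀ z, ‖z‖ = 1 → ‖f z‖ = ‖g z‖ := by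
  obtain ⟨S, m, φ, hS, hφ, hφ0, hfφ⟩ := hf.exists_eq_prod_mul h0
  refine ⟨fun z => (∏ u ∈ S, (1 - conj u * z) ^ m u) * φ z, ?_, fun z hz => ?_, fun z hz => ?_,
    fun z hz => ?_⟩
  · have hpoly : AnalyticOnNhd ℂ (fun z : ℂ => ∏ u ∈ S, (1 - conj u * z) ^ m u)
      (closedBall 0 1) := fun z _ => by fun_prop
    exact hpoly.mul hφ
  · refine mul_ne_zero (Finset.prod_ne_zero_iff.2 fun u hu => pow_ne_zero _ ?_)
      (hφ0 z (ball_subset_closedBall hz))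
    exact one_sub_conj_mul_ne_zero (hS u hu) (by simpa using hz)
  · rw [hfφ z (by simpa using hz), norm_mul, norm_mul, norm_prod, norm_prod]
    gcongr with u hu
    rw [norm_pow, norm_pow]
    gcongr
    exact norm_sub_le_norm_one_sub_conj_mul (hS u hu) hz
  · rw [hfφ z (by simp [hz]), norm_mul, norm_mul, norm_prod, norm_prod]
    congr 1
    refine Finset.prod_congr rfl fun u _ => ?_
    rw [norm_pow, norm_pow, norm_sub_eq_norm_one_sub_conj_mul hz]

/-! ### Zero-free majorants and monotonicity of circle means. -/

lemma enorm_exp_rpow (w : ℂ) {s : ℝ} (q : ℝ) :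
    ‖Complex.exp (s * w)‖ₑ ^ q = ‖Complex.exp w‖ₑ ^ (s * q) := by
  rw [← ofReal_norm, ← ofReal_norm, ENNReal.ofReal_rpow_of_pos (by simp),
    ENNReal.ofReal_rpow_of_pos (by simp), Complex.norm_exp, Complex.norm_exp, ← Real.exp_mul,
    ← Real.exp_mul]
  congr 2
  simp
  ring

/-- Since `|e^h|^q = |e^{qh/2}|²`, the case of exponent 2, where Parseval applies, suffices. -/
lemma circMean_exp_mono {h : ℂ → ℂ} (hh : AnalyticOnNhd ℂ h (ball 0 1)) (q : ℝ) {r s : ℝ}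
    (hr : 0 ≤ r) (hrs : r ≤ s) (hs : s < 1) :
    circMean q (fun z => Complex.exp (h z)) r ≤ circMean q (fun z => Complex.exp (h z)) s := by
  have hu : AnalyticOnNhd ℂ (fun z => Complex.exp ((q / 2 : ℝ) * h z)) (ball 0 1) :=
    (analyticOnNhd_const.mul hh).cexp
  obtain ⟨a, ha⟩ := hu.exists_hasDiscSeries
  have e : ∀ t, circMean q (fun z => Complex.exp (h z)) t =
      circMean 2 (fun z => Complex.exp ((q / 2 : ℝ) * h z)) t := fun t =>
    circMean_congr fun z _ => by rw [enorm_exp_rpow, div_mul_cancel₀ _ two_ne_zero]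
  rw [e, e]
  exact ha.circMean_two_mono hr hrs hs

/-- A nonzero function analytic on the closed disc is dominated in the disc by a zero-free function
whose circle means do not exceed the mean of the given function over the unit circle. -/
lemma AnalyticOnNhd.exists_exp_majorant {f : ℂ → ℂ} (hf : AnalyticOnNhd ℂ f (closedBall 0 1))
    (h0 : ∃ z ∈ closedBall (0 : ℂ) 1, f z ≠ 0) :
    ∃ h : ℂ → ℂ, AnalyticOnNhd ℂ h (ball 0 1) ∧
      (∀ z, ‖z‖ < 1 → ‖f z‖ ≤ ‖Complex.exp (h z)‖) ∧
      ∀ q r, 0 < q → 0 ≤ r → r < 1 →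
        circMean q (fun z => Complex.exp (h z)) r ≤ circMean q f 1 := by
  obtain ⟨g, hg, hg0, hle, heq⟩ := hf.exists_zeroFree_majorant h0
  obtain ⟨h, hh, hexp⟩ := (hg.mono ball_subset_closedBall).exists_exp_eq hg0
  refine ⟨h, hh, fun z hz => ?_, fun q r hq hr hr1 => ?_⟩
  · rw [hexp z (by simpa using hz)]
    exact hle z hz.le
  · have e1 : circMean q f 1 = circMean q g 1 := circMean_congr fun z hz => by
      rw [← ofReal_norm, ← ofReal_norm, heq z (by simpa using hz)]
    have e2 : ∀ t : ℝ, 0 ≤ t → t < 1 →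
        circMean q (fun z => Complex.exp (h z)) t = circMean q g t := fun t ht0 ht =>
      circMean_congr fun z hz => by
        rw [hexp z (by rw [mem_ball_zero_iff, hz, abs_of_nonneg ht0]; exact ht)]
    -- The logarithm `h` exists only in the open disc, as `g` may vanish on the circle. The unit
    -- circle is therefore approached by radii `s n` in `(r, 1)`, using continuity of `g` up to the
    -- boundary.
    obtain ⟨s, -, hs, hslim⟩ := exists_seq_strictMono_tendsto' hr1
    obtain ⟨c, hc⟩ := (isCompact_closedBall (0 : ℂ) 1).exists_bound_of_continuousOn
      hg.continuousOn
    have hs0 : ∀ n, 0 ≤ s n := fun n => hr.trans (hs n).1.le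
    have hmem : ∀ n (θ : ℝ), (s n : ℂ) * Complex.exp (θ * Complex.I) ∈ closedBall (0 : ℂ) 1 := by
      intro n θ
      simpa [Complex.norm_exp_ofReal_mul_I, abs_of_nonneg (hs0 n)] using (hs n).2.le
    have hlim : Tendsto (fun n => circMean q g (s n)) atTop (𝓝 (circMean q g 1)) := by
      refine tendsto_circMean hq (F := fun _ => g) (c := c) (fun n => ?_)
        (fun n θ => hc _ (hmem n θ)) (fun θ => ?_)
      · exact hg.continuousOn.comp_continuous (continuous_circle_param _) (hmem n)
      · have h1 : (1 : ℝ) * Complex.exp (θ * Complex.I) ∈ closedBall (0 : ℂ) 1 := by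
          simp [Complex.norm_exp_ofReal_mul_I]
        refine (hg _ h1).continuousAt.tendsto.comp ?_
        exact ((Complex.continuous_ofReal.tendsto _).comp hslim).mul_const _
    rw [e1]
    refine ge_of_tendsto' hlim fun n => ?_
    rw [← e2 _ (hs0 n) (hs n).2]
    exact circMean_exp_mono hh q hr (hs n).1.le (hs n).2

lemma analyticOnNhd_dilate {f : ℂ → ℂ} (hf : AnalyticOnNhd ℂ f (ball 0 1)) {ρ : ℝ} (h0 : 0 ≤ ρ)
    (h1 : ρ < 1) : AnalyticOnNhd ℂ (fun z => f (ρ * z)) (closedBall 0 1) := by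
  intro z hz
  have hz' : ‖z‖ ≤ 1 := by simpa using hz
  refine AnalyticAt.fun_comp (hf _ ?_) (by fun_prop)
  rw [mem_ball_zero_iff, norm_mul, Complex.norm_of_nonneg h0]
  nlinarith [norm_nonneg z]

/-- Hardy's convexity theorem, in its weak form: circle means of analytic functions increase. -/
lemma circMean_mono_radius {f : ℂ → ℂ} (hf : AnalyticOnNhd ℂ f (ball 0 1)) {q r s : ℝ}
    (hq : 0 < q) (hr : 0 ≤ r) (hrs : r ≤ s) (hs : s < 1) : circMean q f r ≤ circMean q f s := by
  rcases hrs.eq_or_lt with rfl | hrs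
  · rfl
  have hs0 : 0 < s := hr.trans_lt hrs
  have hrs' : r / s < 1 := (div_lt_one hs0).2 hrs
  have hrs0 : 0 ≤ r / s := div_nonneg hr hs0.le
  have e1 : circMean q f r = circMean q (fun z => f (s * z)) (r / s) := by
    rw [circMean_comp_mul, mul_div_cancel₀ _ hs0.ne']
  have e2 : circMean q f s = circMean q (fun z => f (s * z)) 1 := by
    rw [circMean_comp_mul, mul_one]
  rw [e1, e2]
  by_cases h0 : ∃ z ∈ closedBall (0 : ℂ) 1, f (s * z) ≠ 0
  · obtain ⟨h, -, hle, hmean⟩ := (analyticOnNhd_dilate hf hs0.le hs).exists_exp_majorant h0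
    refine le_trans (circMean_mono fun z hz => ?_) (hmean q (r / s) hq hrs0 hrs')
    gcongr
    rw [← ofReal_norm, ← ofReal_norm]
    exact ENNReal.ofReal_le_ofReal (hle z (by rw [hz, abs_of_nonneg hrs0]; exact hrs'))
  · push Not at h0
    refine (circMean_le_of_le fun z hz => ?_).trans zero_le
    rw [h0 z (by rw [mem_closedBall_zero_iff, hz, abs_of_nonneg hrs0]; exact hrs'.le)]
    simp [hq]

/-! ### The inequality for functions analytic on the closed disc. -/

lemma bergmanNorm_rpow_mono {q α : ℝ} (hq : 0 < q) {f g : ℂ → ℂ}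
    (h : ∀ z, ‖z‖ < 1 → ‖f z‖ ≤ ‖g z‖) :
    bergmanNorm q α f ^ q ≤ bergmanNorm q α g ^ q := by
  have h' : ∀ z, ‖z‖ < 1 → ‖f z‖ₑ ^ q ≤ ‖g z‖ₑ ^ q := fun z hz => by
    gcongr
    rw [← ofReal_norm, ← ofReal_norm]
    exact ENNReal.ofReal_le_ofReal (h z hz)
  by_cases hα : α = 1
  · subst hα
    rw [bergmanNorm_one_rpow hq, bergmanNorm_one_rpow hq]
    refine iSup₂_mono fun r hr => circMean_mono fun z hz => h' z ?_
    rw [hz, abs_of_pos hr.1]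
    exact hr.2
  · rw [bergmanNorm_rpow hq hα, bergmanNorm_rpow hq hα]
    refine setLIntegral_mono' measurableSet_ball fun z hz => ?_
    exact mul_le_mul_left (h' z (by simpa using hz)) _

lemma bergmanNorm_zero_rpow {q α : ℝ} (hq : 0 < q) :
    bergmanNorm q α (fun _ => 0) ^ q = 0 := by
  by_cases hα : α = 1
  · subst hα
    simp [bergmanNorm_one_rpow hq, circMean, hq]
  · simp [bergmanNorm_rpow hq hα, bergmanIntegral, hq]

lemma circMean_lt_top {q r : ℝ} (hq : 0 < q) {f : ℂ → ℂ}
    (hf : ContinuousOn f (closedBall 0 |r|)) : circMean q f r < ∞ := by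
  obtain ⟨c, hc⟩ := (isCompact_closedBall (0 : ℂ) |r|).exists_bound_of_continuousOn hf
  refine (circMean_le_of_le (c := ENNReal.ofReal c ^ q) fun z hz => ?_).trans_lt
    (ENNReal.rpow_lt_top_of_nonneg hq.le ENNReal.ofReal_ne_top)
  gcongr
  rw [← ofReal_norm]
  exact ENNReal.ofReal_le_ofReal (hc z (by simp [hz]))

/-- The contractive inequality for functions analytic on the closed disc. -/
lemma bergmanNorm_rpow_le_of_analyticOnNhd_closedBall {p₀ α : ℝ} {C : ℝ≥0} (hp₀ : 0 < p₀)
    (hα : 1 ≤ α) (H : ∀ f : ℂ → ℂ, MemHardy p₀ f →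
      bergmanNorm (p₀ * α) α f ≤ (C : ℝ≥0∞) ^ (2 / p₀) * hardyNorm p₀ f)
    {p : ℝ} {k : ℕ} (hp : 0 < p) (hk : 0 < k) {f : ℂ → ℂ}
    (hf : AnalyticOnNhd ℂ f (closedBall 0 1)) :
    bergmanNorm (k * p * α) (k * α) f ^ (k * p * α) ≤
      ((C : ℝ≥0∞) ^ (2 / p) * circMean p f 1 ^ (1 / p)) ^ (k * p * α) := by
  have hα0 : 0 < α := by linarith
  have hk0 : (0 : ℝ) < k := by exact_mod_cast hk
  have hq : 0 < k * p * α := by positivity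
  by_cases h0 : ∃ z ∈ closedBall (0 : ℂ) 1, f z ≠ 0
  swap
  · push Not at h0
    refine le_trans (bergmanNorm_rpow_mono hq (g := fun _ => 0) fun z hz => ?_)
      ((bergmanNorm_zero_rpow hq).le.trans zero_le)
    rw [h0 z (by simpa using hz.le)]
  obtain ⟨h, hh, hle, hmean⟩ := hf.exists_exp_majorant h0
  set M := circMean p f 1 with hM
  have hMtop : M < ∞ := circMean_lt_top hp (by simpa using hf.continuousOn)
  -- The power `G` of `e^h` with `|G|^{p₀} = |e^h|^p`, to which the hypothesis applies.
  have hGan : AnalyticOnNhd ℂ (fun z => Complex.exp ((p / p₀ : ℝ) * h z)) (ball 0 1) :=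
    (analyticOnNhd_const.mul hh).cexp
  have hGnorm : hardyNorm p₀ (fun z => Complex.exp ((p / p₀ : ℝ) * h z)) ≤ M ^ (1 / p₀) := by
    rw [← ENNReal.rpow_le_rpow_iff hp₀, hardyNorm_rpow hp₀, one_div,
      ENNReal.rpow_inv_rpow hp₀.ne']
    refine iSup₂_le fun r hr => le_trans (le_of_eq ?_) (hmean p r hp hr.1.le hr.2)
    exact circMean_congr fun z _ => by rw [enorm_exp_rpow, div_mul_cancel₀ _ hp₀.ne']
  have hG := H _ ⟨hGan, hGnorm.trans_lt (ENNReal.rpow_lt_top_of_nonneg (by positivity) hMtop.ne)⟩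
  -- The power `u` of `e^h` with `|u|² = |e^h|^{pα} = |G|^{p₀α}`, which moves the estimate to the
  -- Hilbert space `A²_α`.
  have huan : AnalyticOnNhd ℂ (fun z => Complex.exp ((p * α / 2 : ℝ) * h z)) (ball 0 1) :=
    (analyticOnNhd_const.mul hh).cexp
  have hu : bergmanNorm 2 α (fun z => Complex.exp ((p * α / 2 : ℝ) * h z)) ^ (2 : ℝ) ≤
      ((C : ℝ≥0∞) ^ (2 / p₀) * M ^ (1 / p₀)) ^ (p₀ * α) := by
    calc _ = bergmanNorm (p₀ * α) α (fun z => Complex.exp ((p / p₀ : ℝ) * h z)) ^ (p₀ * α) :=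
          bergmanNorm_rpow_congr two_pos (by positivity) fun z _ => by
            rw [enorm_exp_rpow, enorm_exp_rpow]
            congr 1
            field_simp
      _ ≤ _ := by
          gcongr
          exact hG.trans (by gcongr)
  calc bergmanNorm (k * p * α) (k * α) f ^ (k * p * α)
      ≤ bergmanNorm (k * p * α) (k * α) (fun z => Complex.exp (h z)) ^ (k * p * α) :=
        bergmanNorm_rpow_mono hq hle
    _ = bergmanNorm 2 (k * α) (fun z => Complex.exp ((p * α / 2 : ℝ) * h z) ^ k) ^ (2 : ℝ) :=
        bergmanNorm_rpow_congr hq two_pos fun z _ => by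
          rw [enorm_pow, ← ENNReal.rpow_natCast, ← ENNReal.rpow_mul, enorm_exp_rpow]
          congr 1
          field_simp
    _ ≤ (((C : ℝ≥0∞) ^ (2 / p₀) * M ^ (1 / p₀)) ^ (p₀ * α)) ^ k :=
        (bergmanNorm_two_pow_le huan hα hk).trans (by gcongr)
    _ = _ := by
        rw [← ENNReal.rpow_natCast, ← ENNReal.rpow_mul,
          ENNReal.mul_rpow_of_nonneg _ _ (by positivity),
          ENNReal.mul_rpow_of_nonneg _ _ (by positivity), ← ENNReal.rpow_mul, ← ENNReal.rpow_mul,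
          ← ENNReal.rpow_mul, ← ENNReal.rpow_mul]
        congr 2 <;> field_simp

lemma bergmanNorm_dilate_rpow_le {p₀ α : ℝ} {C : ℝ≥0} (hp₀ : 0 < p₀)
    (hα : 1 ≤ α) (H : ∀ f : ℂ → ℂ, MemHardy p₀ f →
      bergmanNorm (p₀ * α) α f ≤ (C : ℝ≥0∞) ^ (2 / p₀) * hardyNorm p₀ f)
    {p : ℝ} {k : ℕ} (hp : 0 < p) (hk : 0 < k) {f : ℂ → ℂ}
    (hf : AnalyticOnNhd ℂ f (ball 0 1)) {ρ : ℝ} (hρ : ρ ∈ Ioo (0 : ℝ) 1) :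
    bergmanNorm (k * p * α) (k * α) (fun z => f (ρ * z)) ^ (k * p * α) ≤
      ((C : ℝ≥0∞) ^ (2 / p) * hardyNorm p f) ^ (k * p * α) := by
  refine (bergmanNorm_rpow_le_of_analyticOnNhd_closedBall hp₀ hα H hp hk
    (analyticOnNhd_dilate hf hρ.1.le hρ.2)).trans ?_
  have hk0 : (0 : ℝ) < k := by exact_mod_cast hk
  gcongr
  rw [← ENNReal.rpow_le_rpow_iff hp, hardyNorm_rpow hp, one_div, ENNReal.rpow_inv_rpow hp.ne',
    circMean_comp_mul, mul_one]
  exact le_iSup₂ (f := fun r _ => circMean p f r) ρ hρ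

/-! ### Limits of dilations. -/

lemma aemeasurable_circMean (q : ℝ) {f : ℂ → ℂ} (hf : ContinuousOn f (ball 0 1)) :
    AEMeasurable (circMean q f) (volume.restrict (Ioo 0 1)) := by
  classical
  set g : ℂ → ℂ := (ball (0 : ℂ) 1).piecewise f 0 with hg
  have hgm : Measurable g := hf.measurable_piecewise continuousOn_const measurableSet_ball
  refine ⟨circMean q g, ?_, ?_⟩
  · refine Measurable.lintegral_prod_right' (f := fun x : ℝ × ℝ =>
      ‖g (x.1 * Complex.exp (x.2 * Complex.I))‖ₑ ^ q * ENNReal.ofReal (1 / (2 * Real.pi))) ?_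
    refine (((hgm.comp ?_).enorm).pow_const q).mul_const _
    fun_prop
  · refine (ae_restrict_iff' measurableSet_Ioo).2 (ae_of_all _ fun r hr => ?_)
    refine circMean_congr fun z hz => ?_
    rw [hg, piecewise_eq_of_mem _ _ _]
    rw [mem_ball_zero_iff, hz, abs_of_pos hr.1]
    exact hr.2

/-- A substitute for the triangle inequality, uniform over `q < 1` and `q ≥ 1`. -/
lemma ENNReal.add_rpow_le_two_rpow_mul (x y : ℝ≥0∞) {q : ℝ} (hq : 0 < q) :
    (x + y) ^ q ≤ 2 ^ q * (x ^ q + y ^ q) := by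
  calc (x + y) ^ q ≤ (2 * max x y) ^ q := by
        gcongr
        rw [two_mul]
        exact add_le_add (le_max_left _ _) (le_max_right _ _)
    _ = 2 ^ q * max x y ^ q := ENNReal.mul_rpow_of_nonneg _ _ hq.le
    _ ≤ _ := by
        gcongr
        rcases max_choice x y with h | h <;> rw [h]
        · exact le_self_add
        · exact le_add_self

lemma enorm_sub_rpow_le (x y : ℂ) {q : ℝ} (hq : 0 < q) :
    ‖x - y‖ₑ ^ q ≤ 2 ^ q * (‖x‖ₑ ^ q + ‖y‖ₑ ^ q) :=
  (ENNReal.rpow_le_rpow enorm_sub_le hq.le).trans (ENNReal.add_rpow_le_two_rpow_mul _ _ hq)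

lemma continuous_comp_circle {f : ℂ → ℂ} (hf : ContinuousOn f (ball 0 1)) {r : ℝ}
    (hr : r ∈ Ioo (0 : ℝ) 1) : Continuous fun θ : ℝ => f (r * Complex.exp (θ * Complex.I)) := by
  refine hf.comp_continuous (continuous_circle_param r) fun θ => ?_
  simpa [Complex.norm_exp_ofReal_mul_I, abs_of_pos hr.1] using hr.2

lemma circMean_sub_le {q : ℝ} (hq : 0 < q) {f g : ℂ → ℂ} (hf : ContinuousOn f (ball 0 1))
    {r : ℝ} (hr : r ∈ Ioo (0 : ℝ) 1) :
    circMean q (fun z => f z - g z) r ≤ 2 ^ q * (circMean q f r + circMean q g r) := by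
  have hfc := continuous_comp_circle hf hr
  unfold circMean
  rw [← lintegral_add_left ((hfc.measurable.enorm.pow_const q).mul_const _),
    ← lintegral_const_mul' _ _ (ENNReal.rpow_ne_top_of_nonneg hq.le ENNReal.ofNat_ne_top)]
  refine lintegral_mono fun θ => ?_
  dsimp only
  rw [← add_mul, ← mul_assoc]
  gcongr
  exact enorm_sub_rpow_le _ _ hq

lemma bergmanIntegral_sub_le {q β : ℝ} (hq : 0 < q) (hβ : 1 < β) {f g : ℂ → ℂ}
    (hf : ContinuousOn f (ball 0 1)) (hg : ContinuousOn g (ball 0 1)) :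
    bergmanIntegral q β (fun z => f z - g z) ≤
      2 ^ q * (bergmanIntegral q β f + bergmanIntegral q β g) := by
  have hfg : ContinuousOn (fun z => f z - g z) (ball 0 1) := hf.sub hg
  have hm : AEMeasurable (fun r => circMean q f r * radialWeight β r)
      (volume.restrict (Ioo 0 1)) :=
    (aemeasurable_circMean q hf).mul (measurable_radialWeight β).aemeasurable
  rw [bergmanIntegral_eq_lintegral_circMean hβ hf, bergmanIntegral_eq_lintegral_circMean hβ hg,
    bergmanIntegral_eq_lintegral_circMean hβ hfg, ← lintegral_add_left' hm,
    ← lintegral_const_mul' _ _ (ENNReal.rpow_ne_top_of_nonneg hq.le ENNReal.ofNat_ne_top)]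
  refine setLIntegral_mono' measurableSet_Ioo fun r hr => ?_
  rw [← add_mul, ← mul_assoc]
  gcongr
  exact circMean_sub_le hq hf hr

/-- Circle means of a continuous combination of `f` and its dilations converge. -/
lemma tendsto_circMean_dilate {q : ℝ} (hq : 0 < q) {f : ℂ → ℂ}
    (hf : ContinuousOn f (ball 0 1)) {ρ : ℕ → ℝ} (hρ : ∀ n, ρ n ∈ Ioo (0 : ℝ) 1)
    (hρlim : Tendsto ρ atTop (𝓝 1)) {Φ : ℂ → ℂ → ℂ} (hΦ : Continuous fun x : ℂ × ℂ => Φ x.1 x.2)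
    {r : ℝ} (hr : r ∈ Ioo (0 : ℝ) 1) :
    Tendsto (fun n => circMean q (fun z => Φ (f z) (f (ρ n * z))) r) atTop
      (𝓝 (circMean q (fun z => Φ (f z) (f z)) r)) := by
  have hsub : closedBall (0 : ℂ) r ⊆ ball 0 1 := closedBall_subset_ball hr.2
  have hK : IsCompact (f '' closedBall 0 r) :=
    (isCompact_closedBall _ _).image_of_continuousOn (hf.mono hsub)
  obtain ⟨c, hc⟩ := (hK.prod hK).exists_bound_of_continuousOn hΦ.continuousOn
  have hm1 : ∀ θ : ℝ, (r : ℂ) * Complex.exp (θ * Complex.I) ∈ closedBall (0 : ℂ) r := fun θ => by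
    simp [Complex.norm_exp_ofReal_mul_I, abs_of_pos hr.1]
  have hm2 : ∀ n (θ : ℝ), (ρ n : ℂ) * (r * Complex.exp (θ * Complex.I)) ∈
      closedBall (0 : ℂ) r := fun n θ => by
    have := hρ n
    simp only [mem_closedBall_zero_iff, norm_mul, Complex.norm_exp_ofReal_mul_I, mul_one,
      Complex.norm_real, Real.norm_eq_abs, abs_of_pos hr.1, abs_of_pos this.1]
    nlinarith [this.2, hr.1]
  refine tendsto_circMean (s := fun _ => r) hq (c := c) (fun n => ?_) (fun n θ => ?_) fun θ => ?_
  · refine hΦ.comp ((continuous_comp_circle hf hr).prodMk ?_)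
    exact hf.comp_continuous ((continuous_circle_param r).const_mul _) fun θ => hsub (hm2 n θ)
  · exact hc (_, _) ⟨mem_image_of_mem f (hm1 θ), mem_image_of_mem f (hm2 n θ)⟩
  · have hcont := (hf.continuousAt (isOpen_ball.mem_nhds (hsub (hm1 θ)))).tendsto
    have h1 : Tendsto (fun n => (ρ n : ℂ) * (r * Complex.exp (θ * Complex.I))) atTop
        (𝓝 (r * Complex.exp (θ * Complex.I))) := by
      simpa using ((Complex.continuous_ofReal.tendsto _).comp hρlim).mul_const
        ((r : ℂ) * Complex.exp (θ * Complex.I))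
    exact (hΦ.tendsto (f (r * Complex.exp (θ * Complex.I)),
      f (r * Complex.exp (θ * Complex.I)))).comp
      (tendsto_const_nhds.prodMk_nhds (hcont.comp h1))

lemma continuousOn_dilate {f : ℂ → ℂ} (hf : AnalyticOnNhd ℂ f (ball 0 1)) {ρ : ℝ}
    (hρ : ρ ∈ Ioo (0 : ℝ) 1) : ContinuousOn (fun z => f (ρ * z)) (ball 0 1) :=
  (analyticOnNhd_dilate hf hρ.1.le hρ.2).continuousOn.mono ball_subset_closedBall

/-- A bound on the norms of all dilations passes to the function itself. -/
lemma bergmanNorm_rpow_le_of_dilate {q β : ℝ} (hq : 0 < q) (hβ : 1 ≤ β) {f : ℂ → ℂ}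
    (hf : AnalyticOnNhd ℂ f (ball 0 1)) {B : ℝ≥0∞}
    (hB : ∀ ρ ∈ Ioo (0 : ℝ) 1, bergmanNorm q β (fun z => f (ρ * z)) ^ q ≤ B) :
    bergmanNorm q β f ^ q ≤ B := by
  rcases hβ.eq_or_lt with rfl | hβ
  · rw [bergmanNorm_one_rpow hq]
    refine iSup₂_le fun r hr => ?_
    -- Any `ρ` strictly between `r` and 1 would do: the circle of radius `r` for `f` is that of
    -- radius `r / ρ < 1` for the dilation.
    have hρ : (1 + r) / 2 ∈ Ioo (0 : ℝ) 1 := ⟨by linarith [hr.1], by linarith [hr.2]⟩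
    have hr' : r / ((1 + r) / 2) ∈ Ioo (0 : ℝ) 1 :=
      ⟨div_pos hr.1 hρ.1, (div_lt_one hρ.1).2 (by linarith [hr.2])⟩
    have := hB _ hρ
    rw [bergmanNorm_one_rpow hq] at this
    refine le_trans (le_of_eq ?_) ((le_iSup₂ (f := fun r _ => circMean q _ r) _ hr').trans this)
    rw [circMean_comp_mul, mul_div_cancel₀ _ hρ.1.ne']
  · obtain ⟨ρ, -, hρ, hρlim⟩ := exists_seq_strictMono_tendsto' (zero_lt_one' ℝ)
    rw [bergmanNorm_rpow hq hβ.ne', bergmanIntegral_eq_lintegral_circMean hβ hf.continuousOn]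
    -- Writing the integrand as a lower limit over dilations prepares for Fatou's lemma.
    have hlim : ∀ r ∈ Ioo (0 : ℝ) 1, circMean q f r * radialWeight β r =
        liminf (fun n => circMean q (fun z => f (ρ n * z)) r * radialWeight β r) atTop := by
      intro r hr
      refine (Tendsto.liminf_eq (ENNReal.Tendsto.mul_const ?_ (Or.inr ENNReal.ofReal_ne_top))).symm
      exact tendsto_circMean_dilate hq hf.continuousOn hρ hρlim (Φ := fun _ y => y)
        continuous_snd hr
    rw [setLIntegral_congr_fun measurableSet_Ioo hlim]
    refine (lintegral_liminf_le' fun n => (aemeasurable_circMean q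
      (continuousOn_dilate hf (hρ n))).mul (measurable_radialWeight β).aemeasurable).trans ?_
    refine liminf_le_of_le (by isBoundedDefault) fun b hb => ?_
    obtain ⟨n, hn⟩ := hb.exists
    refine hn.trans ?_
    have := hB _ (hρ n)
    rwa [bergmanNorm_rpow hq hβ.ne',
      bergmanIntegral_eq_lintegral_circMean hβ (continuousOn_dilate hf (hρ n))] at this

/-- Dilations converge in the Bergman space. -/
lemma tendsto_bergmanIntegral_sub_dilate {q β : ℝ} (hq : 0 < q) (hβ : 1 < β) {f : ℂ → ℂ}
    (hf : AnalyticOnNhd ℂ f (ball 0 1)) (hfin : bergmanIntegral q β f ≠ ∞) {ρ : ℕ → ℝ}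
    (hρ : ∀ n, ρ n ∈ Ioo (0 : ℝ) 1) (hρlim : Tendsto ρ atTop (𝓝 1)) :
    Tendsto (fun n => bergmanIntegral q β fun z => f z - f (ρ n * z)) atTop (𝓝 0) := by
  have hc := hf.continuousOn
  have h2 : (2 : ℝ≥0∞) ^ q ≠ ∞ := ENNReal.rpow_ne_top_of_nonneg hq.le ENNReal.ofNat_ne_top
  have hsub : ∀ n, ContinuousOn (fun z => f z - f (ρ n * z)) (ball 0 1) := fun n =>
    hc.sub (continuousOn_dilate hf (hρ n))
  simp only [fun n => bergmanIntegral_eq_lintegral_circMean (q := q) hβ (hsub n)]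
  rw [bergmanIntegral_eq_lintegral_circMean hβ hc] at hfin
  -- Dominated convergence is applied in the radial variable only. The circle mean of a dilation at
  -- `r` is that of `f` at `ρ n * r`, so `circMean_mono_radius` supplies the majorant.
  have := tendsto_lintegral_of_dominated_convergence' (μ := volume.restrict (Ioo (0 : ℝ) 1))
    (F := fun n r => circMean q (fun z => f z - f (ρ n * z)) r * radialWeight β r)
    (f := fun _ => 0) (fun r => 2 ^ q * 2 * (circMean q f r * radialWeight β r))
    (fun n => (aemeasurable_circMean q (hsub n)).mul (measurable_radialWeight β).aemeasurable)
    (fun n => (ae_restrict_iff' measurableSet_Ioo).2 (ae_of_all _ fun r hr => ?_))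
    (by
      rw [lintegral_const_mul' _ _ (ENNReal.mul_ne_top h2 ENNReal.ofNat_ne_top)]
      exact ENNReal.mul_ne_top (ENNReal.mul_ne_top h2 ENNReal.ofNat_ne_top) hfin)
    ((ae_restrict_iff' measurableSet_Ioo).2 (ae_of_all _ fun r hr => ?_))
  · simpa using this
  · dsimp only
    rw [← mul_assoc]
    gcongr
    refine (circMean_sub_le hq hc hr).trans ?_
    rw [mul_assoc, two_mul, circMean_comp_mul]
    gcongr
    refine circMean_mono_radius hf hq (mul_nonneg (hρ n).1.le hr.1.le) ?_ hr.2
    nlinarith [(hρ n).2, hr.1]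
  · have h := tendsto_circMean_dilate hq hc hρ hρlim (Φ := fun x y => x - y)
      (continuous_fst.sub continuous_snd) hr
    have h' := ENNReal.Tendsto.mul_const (b := radialWeight β r) h
      (Or.inr ENNReal.ofReal_ne_top)
    simpa [circMean, hq] using h'

/-! ### Polynomial approximation and conclusion. -/

/-- The Taylor series of `f` converges absolutely at `ρ < 1`, so that of the dilation converges
uniformly on the disc. -/
lemma exists_polynomial_near_dilate {f : ℂ → ℂ} (hf : AnalyticOnNhd ℂ f (ball 0 1)) {ρ : ℝ}
    (hρ : ρ ∈ Ioo (0 : ℝ) 1) {δ : ℝ} (hδ : 0 < δ) :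
    ∃ P : Polynomial ℂ, ∀ z : ℂ, ‖z‖ < 1 → ‖P.eval z - f (ρ * z)‖ ≤ δ := by
  obtain ⟨a, ha⟩ := hf.exists_hasDiscSeries
  have hsum : Summable fun n => ‖a n * (ρ : ℂ) ^ n‖ :=
    (ha ρ (by simpa [abs_of_pos hρ.1] using hρ.2)).summable.norm
  have hunif := tendstoUniformlyOn_tsum_nat (f := fun n (z : ℂ) => a n * (ρ * z) ^ n) hsum
    (s := ball 0 1) (fun n z hz => by
      have hz' : ‖z‖ ≤ 1 := (mem_ball_zero_iff.1 hz).le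
      rw [mul_pow, ← mul_assoc, norm_mul _ (z ^ n), norm_pow z]
      exact mul_le_of_le_one_right (norm_nonneg _) (pow_le_one₀ (norm_nonneg _) hz'))
  obtain ⟨N, hN⟩ := (Metric.tendstoUniformlyOn_iff.1 hunif δ hδ).exists
  refine ⟨∑ n ∈ Finset.range N, Polynomial.monomial n (a n * (ρ : ℂ) ^ n), fun z hz => ?_⟩
  have h1 := (hN z (by simpa using hz)).le
  rw [dist_comm, dist_eq_norm, (ha (ρ * z) (by
    rw [norm_mul, Complex.norm_of_nonneg hρ.1.le]
    nlinarith [hρ.1, hρ.2, norm_nonneg z])).tsum_eq] at h1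
  simpa [Polynomial.eval_finsetSum, mul_pow, mul_assoc] using h1

lemma bergmanIntegral_le_of_norm_le {q β : ℝ} (hq : 0 < q) (hβ : 1 < β) {f : ℂ → ℂ}
    (hf : ContinuousOn f (ball 0 1)) {δ : ℝ} (h : ∀ z, ‖z‖ < 1 → ‖f z‖ ≤ δ) :
    bergmanIntegral q β f ≤ ENNReal.ofReal δ ^ q := by
  rw [bergmanIntegral_eq_lintegral_circMean hβ hf]
  calc _ ≤ ∫⁻ r in Ioo (0 : ℝ) 1, ENNReal.ofReal δ ^ q * radialWeight β r := by
        refine setLIntegral_mono' measurableSet_Ioo fun r hr => ?_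
        gcongr
        refine circMean_le_of_le fun z hz => ?_
        gcongr
        rw [← ofReal_norm]
        exact ENNReal.ofReal_le_ofReal (h z (by rw [hz, abs_of_pos hr.1]; exact hr.2))
    _ = _ := by
        rw [lintegral_const_mul' _ _ (ENNReal.rpow_ne_top_of_nonneg hq.le ENNReal.ofReal_ne_top),
          lintegral_radialWeight hβ, mul_one]

/-- An analytic function of finite Bergman norm lies in the closure of the polynomials. -/
lemma memBergman_of_bergmanNorm_lt_top {q β : ℝ} (hq : 0 < q) (hβ : 1 < β) {f : ℂ → ℂ}
    (hf : AnalyticOnNhd ℂ f (ball 0 1)) (hfin : bergmanNorm q β f < ∞) : MemBergman q β f := by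
  refine Or.inr ⟨hβ.ne', hf, fun ε hε => ?_⟩
  have hfin' : bergmanIntegral q β f ≠ ∞ := by
    rw [← bergmanNorm_rpow hq hβ.ne']
    exact ENNReal.rpow_ne_top_of_nonneg hq.le hfin.ne
  obtain ⟨ρ, -, hρ, hρlim⟩ := exists_seq_strictMono_tendsto' (zero_lt_one' ℝ)
  choose P hP using fun n : ℕ => exists_polynomial_near_dilate hf (hρ n)
    (Nat.one_div_pos_of_nat (α := ℝ) (n := n))
  have hlim : Tendsto (fun n : ℕ => 2 ^ q * (bergmanIntegral q β (fun z => f z - f (ρ n * z)) +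
      ENNReal.ofReal (1 / ((n : ℝ) + 1)) ^ q)) atTop (𝓝 0) := by
    have h1 : Tendsto (fun n : ℕ => ENNReal.ofReal (1 / ((n : ℝ) + 1)) ^ q) atTop (𝓝 0) := by
      have := (ENNReal.continuous_rpow_const (y := q)).tendsto _ |>.comp
        ((ENNReal.continuous_ofReal.tendsto 0).comp tendsto_one_div_add_atTop_nhds_zero_nat)
      simpa [hq, Function.comp_def] using this
    have h2 := ENNReal.Tendsto.const_mul
      ((tendsto_bergmanIntegral_sub_dilate hq hβ hf hfin' hρ hρlim).add h1)
      (Or.inr (ENNReal.rpow_ne_top_of_nonneg hq.le (ENNReal.ofNat_ne_top (n := 2))))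
    simpa using h2
  obtain ⟨n, hn⟩ := (hlim.eventually_lt_const (ENNReal.rpow_pos_of_nonneg hε hq.le)).exists
  refine ⟨P n, (ENNReal.rpow_lt_rpow_iff hq).1 (lt_of_le_of_lt ?_ hn)⟩
  rw [bergmanNorm_rpow hq hβ.ne']
  have hc := continuousOn_dilate hf (hρ n)
  have hPc : ContinuousOn (fun z => (P n).eval z - f (ρ n * z)) (ball 0 1) :=
    (P n).continuous.continuousOn.sub hc
  have e : (fun z => f z - (P n).eval z) =
      fun z => (f z - f (ρ n * z)) - ((P n).eval z - f (ρ n * z)) := by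
    funext z
    ring
  have hfc : ContinuousOn (fun z => f z - f (ρ n * z)) (ball 0 1) := hf.continuousOn.sub hc
  rw [e]
  refine (bergmanIntegral_sub_le hq hβ hfc hPc).trans ?_
  gcongr
  exact bergmanIntegral_le_of_norm_le hq hβ hPc (hP n)

lemma memBergman_and_bergmanNorm_le {p₀ α : ℝ} {C : ℝ≥0} (hp₀ : 0 < p₀)
    (hα : 1 ≤ α) (H : ∀ f : ℂ → ℂ, MemHardy p₀ f →
      bergmanNorm (p₀ * α) α f ≤ (C : ℝ≥0∞) ^ (2 / p₀) * hardyNorm p₀ f)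
    {p : ℝ} {k : ℕ} (hp : 0 < p) (hk : 0 < k) {f : ℂ → ℂ} (hf : MemHardy p f) :
    MemBergman (k * p * α) (k * α) f ∧
      bergmanNorm (k * p * α) (k * α) f ≤ (C : ℝ≥0∞) ^ (2 / p) * hardyNorm p f := by
  have hα0 : 0 < α := by linarith
  have hk1 : (1 : ℝ) ≤ k := by exact_mod_cast hk
  have hq : 0 < k * p * α := by positivity
  have hβ : 1 ≤ k * α := by nlinarith
  have hle : bergmanNorm (k * p * α) (k * α) f ≤ (C : ℝ≥0∞) ^ (2 / p) * hardyNorm p f :=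
    (ENNReal.rpow_le_rpow_iff hq).1 (bergmanNorm_rpow_le_of_dilate hq hβ hf.1 fun ρ hρ =>
      bergmanNorm_dilate_rpow_le hp₀ hα H hp hk hf.1 hρ)
  refine ⟨?_, hle⟩
  rcases hβ.eq_or_lt with h1 | h1
  -- As `k` and `α` are both at least 1, `k * α = 1` forces both to be 1, and membership is the
  -- Hardy space assumption itself.
  · have hk' : (k : ℝ) = 1 := by nlinarith
    have hα' : α = 1 := by nlinarith
    refine Or.inl ⟨h1.symm, ?_⟩
    rwa [hk', hα', one_mul, mul_one]
  · refine memBergman_of_bergmanNorm_lt_top hq h1 hf.1 (hle.trans_lt ?_)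
    exact ENNReal.mul_lt_top (ENNReal.rpow_lt_top_of_nonneg (by positivity) ENNReal.coe_ne_top) hf.2

theorem corollary2p3 :
    (∀ (p₀ α : ℝ) (C : ℝ≥0), 0 < p₀ → 1 ≤ α →
      (∀ f : ℂ → ℂ, MemHardy p₀ f →
        bergmanNorm (p₀ * α) α f ≤ (C : ℝ≥0∞) ^ (2 / p₀) * hardyNorm p₀ f) →
      ∀ (p : ℝ) (k : ℕ), 0 < p → 0 < k → ∀ f : ℂ → ℂ, MemHardy p f →
        MemBergman (k * p * α) (k * α) f ∧
          bergmanNorm (k * p * α) (k * α) f ≤ (C : ℝ≥0∞) ^ (2 / p) * hardyNorm p f) ∧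
    (∀ (p : ℝ) (k : ℕ), 0 < p → 0 < k → ∀ f : ℂ → ℂ, MemHardy p f →
      MemBergman (k * p) k f ∧ bergmanNorm (k * p) k f ≤ hardyNorm p f) := by
  refine ⟨fun p₀ α C hp₀ hα H p k hp hk f hf => memBergman_and_bergmanNorm_le hp₀ hα H hp hk hf,
    fun p k hp hk f hf => ?_⟩
  -- For `α = 1` the hypothesis holds trivially with constant 1, since `A^p_1 = H^p` by convention.
  simpa using memBergman_and_bergmanNorm_le (p₀ := 1) (α := 1) (C := 1) one_pos le_rfl
    (fun g _ => by simp [bergmanNorm]) hp hk hf
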